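/- For $f\in\mathcal S'(\mathbb R^n)$ let $\widehat f$ be its Fourier transform, normalized so that $\widehat f(\xi)=(2\pi)^{-n/2}\int_{\mathbb R^n}e^{-ix\cdot\xi}f(x)\,dx$ for integrable $f$, let $f^\vee$ be the inverse transform, and let $e^{it\Delta}f=(e^{-it|\xi|^2}\widehat f\,)^{\vee}$. For exponents $p,q$ and $A_1,A_2>0$ write $f=O_{p,q}(A_1;A_2)$ if $f$ and $\widehat f$ are functions with $e^{A_1|\cdot|^2}f\in L^p(\mathbb R^n)$ and $e^{A_2|\cdot|^2}\widehat f\in L^q(\mathbb R^n)$; the number attached to this relation is $M_{p,q}(f)=A_1A_2$ (it depends on the constants in the relation and not on $f$ alone). Write $O_p$ for $O_{p,p}$. Let $p,q,r\in[1,\infty]$, $1/p+1/r=1/l$ (so $l\in[1/2,\infty]$), $A_1,A_2,B_1,B_2,C_1,C_2>0$, and $f,g,h\in\mathcal S'(\mathbb R^n)$. (a) If $f=O_{p,q}(A_1;A_2)$, then $\widehat f=O_{q,p}(A_2;A_1)$. (b) If $f=O_{p,q}(A_1;A_2)$ and $g=O_{r,q}(B_1;B_2)$, then the pointwise product $fg$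 is a tempered distribution, $fg=O_{l,q}\big(A_1+B_1;\,A_2B_2/(A_2+B_2)\big)$, and the number attached to this relation satisfies \[M_{l,q}(fg)\le\frac{B_2}{A_2+B_2}M_{p,q}(f)+\frac{A_2}{A_2+B_2}M_{r,q}(g).\] (c) If $f=O_{q,p}(A_1;A_2)$ and $g=O_{q,r}(B_1;B_2)$, then the convolution $g*f$ is well defined as a tempered distribution and $g*f=O_{q,l}\big(A_1B_1/(A_1+B_1);\,A_2+B_2\big)$. (d) If $h=O_2(C_1;C_2)$ and $t>0$, then \[e^{it\Delta}h=O_2\Big(\frac{C_1C_2}{C_2+4t\sqrt{C_1C_2}+4t^2C_1};\,C_2\Big).\] (e) If $h=O_2(C_1;C_2)$ and $\tau>0$, then \[e^{-i\tau|\cdot|^2}h=O_2\Big(C_1;\,\frac{C_1C_2}{C_1+4\tau\sqrt{C_1C_2}+4\tau^2C_2}\Big).\] -/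

import Mathlib

open MeasureTheory
open scoped SchwartzMap FourierTransform ENNReal

noncomputable section

namespace GaussianDecay

/-- The Euclidean space `ℝⁿ`. -/
abbrev Rn (n : ℕ) : Type := EuclideanSpace ℝ (Fin n)

/-- The linear change of variables `ξ ↦ ξ / (2π)` on `ℝⁿ`. -/
def scaling (n : ℕ) : Rn n ≃L[ℝ] Rn n :=
  ContinuousLinearEquiv.smulLeft
    (Units.mk0 ((2 * Real.pi)⁻¹ : ℝ) (inv_ne_zero (mul_pos two_pos Real.pi_pos).ne'))

/-- The factor `(2π)^{-n/2}`. -/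
def normConst (n : ℕ) : ℂ := (((2 * Real.pi) ^ (-(n : ℝ) / 2) : ℝ) : ℂ)

/-- The Fourier transform `φ ↦ (2π)^{-n/2} ∫ e^{-i x·ξ} φ(x) dx` on Schwartz functions
(see `schwartzFT_apply`). -/
def schwartzFT (n : ℕ) : 𝓢(Rn n, ℂ) →L[ℂ] 𝓢(Rn n, ℂ) :=
  normConst n • (SchwartzMap.compCLMOfContinuousLinearEquiv ℂ (scaling n) ∘L
    FourierTransform.fourierCLM ℂ 𝓢(Rn n, ℂ))

/-- The inverse transform `φ ↦ (2π)^{-n/2} ∫ e^{i x·ξ} φ(ξ) dξ` on Schwartz functions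
(see `schwartzFTInv_apply`). -/
def schwartzFTInv (n : ℕ) : 𝓢(Rn n, ℂ) →L[ℂ] 𝓢(Rn n, ℂ) :=
  normConst n • (SchwartzMap.compCLMOfContinuousLinearEquiv ℂ (scaling n) ∘L
    FourierTransform.fourierInvCLM ℂ 𝓢(Rn n, ℂ))

theorem schwartzFT_apply (n : ℕ) (φ : 𝓢(Rn n, ℂ)) (ξ : Rn n) :
    schwartzFT n φ ξ =
      normConst n * ∫ x : Rn n, Complex.exp (-(Complex.I * (inner ℝ x ξ : ℝ))) * φ x := by
  have h : schwartzFT n φ ξ = normConst n * (𝓕 φ) ((2 * Real.pi)⁻¹ • ξ) := rfl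
  rw [h, SchwartzMap.fourier_coe, Real.fourier_eq']
  congr 1
  refine integral_congr_ae (Filter.Eventually.of_forall fun x => ?_)
  simp only [smul_eq_mul, inner_smul_right]
  congr 2
  have hpi : (Real.pi : ℂ) ≠ 0 := by exact_mod_cast Real.pi_ne_zero
  push_cast
  field_simp

theorem schwartzFTInv_apply (n : ℕ) (φ : 𝓢(Rn n, ℂ)) (x : Rn n) :
    schwartzFTInv n φ x =
      normConst n * ∫ ξ : Rn n, Complex.exp (Complex.I * (inner ℝ ξ x : ℝ)) * φ ξ := by
  have h : schwartzFTInv n φ x = normConst n * (𝓕⁻ φ) ((2 * Real.pi)⁻¹ • x) := rfl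
  rw [h, SchwartzMap.fourierInv_coe, Real.fourierInv_eq']
  congr 1
  refine integral_congr_ae (Filter.Eventually.of_forall fun x => ?_)
  simp only [smul_eq_mul, inner_smul_right]
  congr 2
  have hpi : (Real.pi : ℂ) ≠ 0 := by exact_mod_cast Real.pi_ne_zero
  push_cast
  field_simp

/-- The Fourier transform of a tempered distribution: `⟨f̂, φ⟩ = ⟨f, φ̂⟩`. -/
def ft {n : ℕ} (f : 𝓢'(Rn n, ℂ)) : 𝓢'(Rn n, ℂ) :=
  PointwiseConvergenceCLM.precomp ℂ (schwartzFT n) f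

/-- The inverse Fourier transform of a tempered distribution: `⟨f^∨, φ⟩ = ⟨f, φ^∨⟩`. -/
def ftInv {n : ℕ} (f : 𝓢'(Rn n, ℂ)) : 𝓢'(Rn n, ℂ) :=
  PointwiseConvergenceCLM.precomp ℂ (schwartzFTInv n) f

/-- The function `x ↦ e^{-i s |x|²}`. -/
def chirp (n : ℕ) (s : ℝ) (x : Rn n) : ℂ := Complex.exp (-(Complex.I * s * (‖x‖ ^ 2 : ℝ)))

theorem chirp_hasTemperateGrowth (n : ℕ) (s : ℝ) : (chirp n s).HasTemperateGrowth := by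
  have h1 : (fun u : ℝ => Complex.exp (-(Complex.I * s * u))).HasTemperateGrowth := by
    have e : (fun u : ℝ => Complex.exp (-(Complex.I * s * u))) =
        fun u : ℝ => Complex.exp ((-(Complex.I * s)) * u) := by
      funext u; ring_nf
    have hd : ∀ k : ℕ, iteratedDeriv k (fun u : ℝ => Complex.exp ((-(Complex.I * s)) * u)) =
        fun u : ℝ => (-(Complex.I * s)) ^ k * Complex.exp ((-(Complex.I * s)) * u) := by
      intro k
      induction k with
      | zero => simp
      | succ k ih =>
        rw [iteratedDeriv_succ, ih]
        funext u
        have h2 : HasDerivAt (fun u : ℝ => (-(Complex.I * s)) * (u : ℂ)) (-(Complex.I * s)) u := by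
          simpa using (Complex.ofRealCLM.hasDerivAt (x := u)).const_mul (-(Complex.I * s))
        have h3 := (h2.cexp.const_mul ((-(Complex.I * s)) ^ k)).deriv
        rw [h3]; ring
    rw [e]
    refine ⟨?_, fun k => ⟨0, |s| ^ k, fun u => ?_⟩⟩
    · exact (contDiff_const.mul Complex.ofRealCLM.contDiff).cexp
    · rw [norm_iteratedFDeriv_eq_norm_iteratedDeriv, hd k]
      have h4 : ‖Complex.exp ((-(Complex.I * s)) * (u : ℂ))‖ = 1 := by
        rw [Complex.norm_exp]; simp
      rw [norm_mul, h4]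
      simp
  exact h1.comp (Function.hasTemperateGrowth_norm_sq (H := Rn n))

/-- Multiplication of a tempered distribution by the smooth function `e^{-i s |·|²}`. -/
def chirpMul {n : ℕ} (s : ℝ) (f : 𝓢'(Rn n, ℂ)) : 𝓢'(Rn n, ℂ) :=
  TemperedDistribution.smulLeftCLM ℂ (chirp n s) f

/-- The free Schrödinger group `e^{itΔ} f = (e^{-i t |ξ|²} f̂)^∨` on tempered distributions. -/
def schrodinger {n : ℕ} (t : ℝ) (f : 𝓢'(Rn n, ℂ)) : 𝓢'(Rn n, ℂ) :=
  ftInv (chirpMul t (ft f))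

/-- The tempered distribution `f` is (given by integration against) the function `F`. -/
def IsGivenBy {n : ℕ} (f : 𝓢'(Rn n, ℂ)) (F : Rn n → ℂ) : Prop :=
  LocallyIntegrable F volume ∧
    ∀ φ : 𝓢(Rn n, ℂ), Integrable (fun x => φ x * F x) volume ∧ f φ = ∫ x, φ x * F x

/-- `e^{A|·|²} f ∈ L^p(ℝⁿ)` for a tempered distribution `f`: it is a function with this
property. -/
def WeightedLp {n : ℕ} (p : ℝ≥0∞) (A : ℝ) (f : 𝓢'(Rn n, ℂ)) : Prop :=
  ∃ F : Rn n → ℂ, IsGivenBy f F ∧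
    MemLp (fun x => (Real.exp (A * ‖x‖ ^ 2) : ℂ) * F x) p volume

/-- `f = O_{p,q}(A₁; A₂)`. -/
def IsO {n : ℕ} (p q : ℝ≥0∞) (A₁ A₂ : ℝ) (f : 𝓢'(Rn n, ℂ)) : Prop :=
  WeightedLp p A₁ f ∧ WeightedLp q A₂ (ft f)

/-- The number `M_{p,q}(f) = A₁ A₂` attached to a relation `f = O_{p,q}(A₁; A₂)`. It depends on the
constants of the relation, not on `f` alone. -/
def M (A₁ A₂ : ℝ) : ℝ := A₁ * A₂

/-- `k` is the pointwise product of `f` and `g`, which are functions. -/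
def IsProduct {n : ℕ} (f g k : 𝓢'(Rn n, ℂ)) : Prop :=
  ∃ F G : Rn n → ℂ, IsGivenBy f F ∧ IsGivenBy g G ∧ IsGivenBy k (fun x => F x * G x)

/-- `k` is the convolution `f ∗ g (x) = ∫ f(y) g(x - y) dy` of `f` and `g`, which are functions;
the integral converges absolutely for almost every `x`. -/
def IsConvolution {n : ℕ} (f g k : 𝓢'(Rn n, ℂ)) : Prop :=
  ∃ F G : Rn n → ℂ, IsGivenBy f F ∧ IsGivenBy g G ∧
    (∀ᵐ x : Rn n, Integrable (fun y => F y * G (x - y)) volume) ∧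
    IsGivenBy k (fun x => ∫ y, F y * G (x - y))

end GaussianDecay

end

/-! A Gaussian weight on an `L^p` function with `p ≥ 1` forces integrability
(`integrable_of_memLp_weight`), so the transforms involved are honest integrals and the
distributional statements become statements about functions.

The first three assertions rest on inversion, Hölder and the convolution theorem. Products of
weighted functions are Hölder. For convolutions one completes the square: `A|y|² + B|x-y|²` equals
`AB/(A+B)·|x|²` plus a Gaussian exponent in `y` centred at a multiple of `x`; this leftover Gaussian
makes weighted `L^q` closed under convolution for every `q ≥ 1` (`memLp_weight_convolution`).

The chirp estimate is an interpolation. Let `ĥ = g`, with Gaussian weights `C₁` on `h` and `C₂` on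
`g`. By Plancherel and a contour shift, the weight `e^{-θν·ξ}` on the transform of `e^{-iτ|x|²}h`
gives the `L²` norm of `e^{2τθ x·ν}h(x+iθν)`. The same modulus arises at height `θν` from `e^{iTx² +
2Tν·x}h(x)` with `T = τθ/(1-θ)`. At height `ν` the exponential factor of the latter has modulus one,
leaving the norm of `e^{-ν·ξ}g`; at height `0` it is `e^{2Tν·x}h`. Hölder on the Fourier side gives
log-convexity in the height, taking the place of a three-lines theorem
(`lintegral_tilt_ftFun_chirp_le_of_pos`, with a damping `ε` removed by Fatou). Averaging over `ν`
against a Gaussian turns linear weights into Gaussian ones (`lintegral_gaussian_mul_tilt_sq`), and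
`θ = √C₁/(√C₁ + 2τ√C₂)` matches the exponents, giving the weight `θ²C₂`.

The Schrödinger assertion is the chirp assertion conjugated by the Fourier transform. -/

noncomputable section

namespace GaussianDecay

variable {n : ℕ}

/-! ### Fourier transform and inversion for functions and tempered distributions -/

/-- The Fourier transform `ξ ↦ (2π)^{-n/2} ∫ e^{-i x·ξ} F(x) dx` of a function. -/
def ftFun (F : Rn n → ℂ) (ξ : Rn n) : ℂ :=
  normConst n * ∫ x : Rn n, Complex.exp (-(Complex.I * (inner ℝ x ξ : ℝ))) * F x

/-- The inverse Fourier transform `x ↦ (2π)^{-n/2} ∫ e^{i x·ξ} F(ξ) dξ` of a function. -/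
def ftInvFun (F : Rn n → ℂ) (x : Rn n) : ℂ :=
  normConst n * ∫ ξ : Rn n, Complex.exp (Complex.I * (inner ℝ ξ x : ℝ)) * F ξ

theorem coe_schwartzFT (φ : 𝓢(Rn n, ℂ)) : ⇑(schwartzFT n φ) = ftFun φ :=
  funext fun ξ => schwartzFT_apply n φ ξ

theorem coe_schwartzFTInv (φ : 𝓢(Rn n, ℂ)) : ⇑(schwartzFTInv n φ) = ftInvFun φ :=
  funext fun ξ => schwartzFTInv_apply n φ ξ

theorem ftInvFun_eq_ftFun_neg (F : Rn n → ℂ) (x : Rn n) : ftInvFun F x = ftFun F (-x) := by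
  simp [ftInvFun, ftFun]

theorem ftFun_comp_neg (F : Rn n → ℂ) (x : Rn n) : ftFun (fun y => F (-y)) x = ftInvFun F x := by
  rw [ftInvFun, ftFun, ← integral_neg_eq_self]
  simp

theorem ftFun_eq_fourier (F : Rn n → ℂ) (ξ : Rn n) :
    ftFun F ξ = normConst n * 𝓕 F ((2 * Real.pi)⁻¹ • ξ) := by
  rw [ftFun, Real.fourier_eq']
  congr 1
  refine integral_congr_ae (Filter.Eventually.of_forall fun x => ?_)
  simp only [smul_eq_mul, inner_smul_right]
  congr 2
  have hpi : (Real.pi : ℂ) ≠ 0 := by exact_mod_cast Real.pi_ne_zero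
  push_cast
  field_simp

theorem continuous_ftFun {F : Rn n → ℂ} (hF : Integrable F) : Continuous (ftFun F) := by
  have h : Continuous (𝓕 F) := VectorFourier.fourierIntegral_continuous
    Real.continuous_fourierChar continuous_inner hF
  have e : ftFun F = fun ξ => normConst n * 𝓕 F ((2 * Real.pi)⁻¹ • ξ) :=
    funext (ftFun_eq_fourier F)
  rw [e]
  exact continuous_const.mul (h.comp (continuous_const_smul _))

theorem continuous_ftInvFun {F : Rn n → ℂ} (hF : Integrable F) : Continuous (ftInvFun F) := by
  have e : ftInvFun F = fun ξ => ftFun F (-ξ) := funext (ftInvFun_eq_ftFun_neg F)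
  rw [e]
  exact (continuous_ftFun hF).comp continuous_neg

theorem norm_ftFun_le (F : Rn n → ℂ) (ξ : Rn n) :
    ‖ftFun F ξ‖ ≤ ‖normConst n‖ * ∫ x, ‖F x‖ := by
  rw [ftFun_eq_fourier, norm_mul]
  gcongr
  exact VectorFourier.norm_fourierIntegral_le_integral_norm _ _ _ _ _

theorem norm_ftInvFun_le (F : Rn n → ℂ) (ξ : Rn n) :
    ‖ftInvFun F ξ‖ ≤ ‖normConst n‖ * ∫ x, ‖F x‖ := by
  rw [ftInvFun_eq_ftFun_neg]
  exact norm_ftFun_le F _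

theorem integral_ftFun_mul {F G : Rn n → ℂ} (hF : Integrable F) (hG : Integrable G) :
    ∫ x, ftFun F x * G x = ∫ x, F x * ftFun G x := by
  -- Pairing with `(2π)⁻¹⟨x, ξ⟩` turns the character `e^{-2πi·}` into `e^{-i x·ξ}`.
  have hc : Continuous fun p : Rn n × Rn n => ((2 * Real.pi)⁻¹ • innerₗ (Rn n)) p.1 p.2 := by
    simp only [LinearMap.smul_apply, innerₗ_apply_apply]
    fun_prop
  have h := VectorFourier.integral_fourierIntegral_smul_eq_flip (μ := volume) (ν := volume)
    (L := (2 * Real.pi)⁻¹ • innerₗ (Rn n)) Real.continuous_fourierChar hc hF hG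
  have e : ∀ (H : Rn n → ℂ) ξ, VectorFourier.fourierIntegral Real.fourierChar volume
      ((2 * Real.pi)⁻¹ • innerₗ (Rn n)) H ξ = 𝓕 H ((2 * Real.pi)⁻¹ • ξ) := by
    intro H ξ
    rw [Real.fourier_eq]
    simp [VectorFourier.fourierIntegral, inner_smul_right]
  have e' : ∀ (H : Rn n → ℂ) ξ, VectorFourier.fourierIntegral Real.fourierChar volume
      ((2 * Real.pi)⁻¹ • innerₗ (Rn n)).flip H ξ = 𝓕 H ((2 * Real.pi)⁻¹ • ξ) := by
    intro H ξ
    rw [Real.fourier_eq]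
    simp [VectorFourier.fourierIntegral, inner_smul_right, real_inner_comm ξ]
  simp only [e, e', smul_eq_mul] at h
  simp only [ftFun_eq_fourier, mul_assoc, mul_left_comm _ (normConst n), integral_const_mul]
  rw [h]

theorem integral_ftInvFun_mul {F G : Rn n → ℂ} (hF : Integrable F) (hG : Integrable G) :
    ∫ x, ftInvFun F x * G x = ∫ x, F x * ftInvFun G x := by
  have h := integral_ftFun_mul hF.comp_neg hG
  rw [← integral_neg_eq_self (fun x => F (-x) * ftFun G x)] at h
  simp only [neg_neg] at h
  simp_rw [ftInvFun_eq_ftFun_neg G, ← ftFun_comp_neg F]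
  exact h

theorem normConst_sq_mul (n : ℕ) : normConst n * normConst n * ((2 * Real.pi) ^ n : ℝ) = 1 := by
  have h : (2 * Real.pi) ^ (-(n : ℝ) / 2) * (2 * Real.pi) ^ (-(n : ℝ) / 2) * (2 * Real.pi) ^ n
      = (1 : ℝ) := by
    have h2 : (0 : ℝ) < 2 * Real.pi := by positivity
    rw [← Real.rpow_natCast, ← Real.rpow_add h2, ← Real.rpow_add h2]
    ring_nf
    simp
  rw [normConst]
  exact_mod_cast h

theorem ftInvFun_ftFun (F : Rn n → ℂ) : ftInvFun (ftFun F) = 𝓕⁻ (𝓕 F) := by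
  funext x
  have e : ftFun F = fun ξ => normConst n * 𝓕 F ((2 * Real.pi)⁻¹ • ξ) :=
    funext (ftFun_eq_fourier F)
  have h := Measure.integral_comp_smul (volume : Measure (Rn n))
    (fun η => Complex.exp (2 * Real.pi * Complex.I * (inner ℝ η x : ℝ)) * 𝓕 F η) (2 * Real.pi)⁻¹
  rw [ftInvFun, e, Real.fourierInv_eq']
  simp only [mul_left_comm _ (normConst n), integral_const_mul]
  have h' : ∀ ξ : Rn n, Complex.exp (Complex.I * (inner ℝ ξ x : ℝ)) =
      Complex.exp (2 * Real.pi * Complex.I * (inner ℝ ((2 * Real.pi)⁻¹ • ξ) x : ℝ)) := by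
    intro ξ
    congr 1
    rw [real_inner_smul_left]
    have hpi : (Real.pi : ℂ) ≠ 0 := by exact_mod_cast Real.pi_ne_zero
    push_cast
    field_simp
  simp_rw [h']
  rw [h]
  have hpos : (0 : ℝ) < 2 * Real.pi := by positivity
  rw [finrank_euclideanSpace_fin, inv_pow, inv_inv, abs_of_pos (by positivity), ← mul_assoc,
    Complex.real_smul, ← mul_assoc, normConst_sq_mul, one_mul]
  refine integral_congr_ae (Filter.Eventually.of_forall fun v => ?_)
  simp only [smul_eq_mul]
  congr 2
  push_cast
  ring

theorem ftInvFun_ftFun_schwartz (φ : 𝓢(Rn n, ℂ)) : ftInvFun (ftFun φ) = φ := by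
  rw [ftInvFun_ftFun]
  exact Continuous.fourierInv_fourier_eq φ.continuous φ.integrable
    (by rw [← SchwartzMap.fourier_coe]; exact (𝓕 φ).integrable)

theorem ftFun_ftInvFun_schwartz (φ : 𝓢(Rn n, ℂ)) : ftFun (ftInvFun φ) = φ := by
  -- Only the right-hand `φ` is to be expanded, so the left one is folded back; what remains is that
  -- reflection exchanges the two transforms.
  rw [← ftInvFun_ftFun_schwartz φ]
  funext x
  conv_lhs => rw [ftInvFun_ftFun_schwartz]
  have e : ftInvFun φ = fun y => ftFun φ (-y) := funext (ftInvFun_eq_ftFun_neg φ)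
  rw [e, ftFun_comp_neg]

theorem ftInv_ft (f : 𝓢'(Rn n, ℂ)) : ftInv (ft f) = f := by
  ext φ
  change f (schwartzFT n (schwartzFTInv n φ)) = f φ
  congr 1
  ext x
  rw [coe_schwartzFT, coe_schwartzFTInv, ftFun_ftInvFun_schwartz]

theorem ft_ftInv (f : 𝓢'(Rn n, ℂ)) : ft (ftInv f) = f := by
  ext φ
  change f (schwartzFTInv n (schwartzFT n φ)) = f φ
  congr 1
  ext x
  rw [coe_schwartzFTInv, coe_schwartzFT, ftInvFun_ftFun_schwartz]

/-! ### Distributions represented by functions -/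

theorem integrable_schwartz_mul (φ : 𝓢(Rn n, ℂ)) {F : Rn n → ℂ} (hF : Integrable F) :
    Integrable fun x => φ x * F x := by
  obtain ⟨C, hC⟩ : ∃ C, ∀ x, ‖φ x‖ ≤ C := ⟨_, fun x => SchwartzMap.norm_le_seminorm ℝ φ x⟩
  exact hF.bdd_mul φ.continuous.aestronglyMeasurable (Filter.Eventually.of_forall hC)

theorem exists_isGivenBy {F : Rn n → ℂ} (hF : Integrable F) : ∃ k, IsGivenBy k F := by
  have : Fact ((1 : ℝ≥0∞) ≤ 1) := ⟨le_rfl⟩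
  refine ⟨Lp.toTemperedDistribution (memLp_one_iff_integrable.2 hF).toLp,
    hF.locallyIntegrable, fun φ => ⟨integrable_schwartz_mul φ hF, ?_⟩⟩
  rw [Lp.toTemperedDistribution_apply]
  refine integral_congr_ae ?_
  filter_upwards [(memLp_one_iff_integrable.2 hF).coeFn_toLp] with x hx
  rw [hx, smul_eq_mul]

theorem ae_eq_of_integral_schwartz_mul_eq {F G : Rn n → ℂ} (hF : LocallyIntegrable F)
    (hG : LocallyIntegrable G)
    (h : ∀ φ : 𝓢(Rn n, ℂ), ∫ x, φ x * F x = ∫ x, φ x * G x) : F =ᵐ[volume] G := by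
  refine ae_eq_of_integral_contDiff_smul_eq hF hG fun g hg hc => ?_
  have hg₁ : HasCompactSupport (Complex.ofRealCLM ∘ g) := hc.comp_left rfl
  have hg₂ : ContDiff ℝ (⊤ : ℕ∞) (Complex.ofRealCLM ∘ g) := by fun_prop
  simpa using h (hg₁.toSchwartzMap hg₂)

/-- Makes the existentially quantified representatives in `WeightedLp`, `IsProduct` and
`IsConvolution` interchangeable. -/
theorem IsGivenBy.ae_eq {f : 𝓢'(Rn n, ℂ)} {F G : Rn n → ℂ} (hF : IsGivenBy f F)
    (hG : IsGivenBy f G) : F =ᵐ[volume] G :=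
  ae_eq_of_integral_schwartz_mul_eq hF.1 hG.1 fun φ => by rw [← (hF.2 φ).2, ← (hG.2 φ).2]

theorem IsGivenBy.congr {f : 𝓢'(Rn n, ℂ)} {F G : Rn n → ℂ} (hF : IsGivenBy f F)
    (h : F =ᵐ[volume] G) : IsGivenBy f G := by
  refine ⟨hF.1.congr h, fun φ => ?_⟩
  have e : (fun x => φ x * F x) =ᵐ[volume] fun x => φ x * G x := by
    filter_upwards [h] with x hx
    rw [hx]
  exact ⟨(hF.2 φ).1.congr e, (hF.2 φ).2.trans (integral_congr_ae e)⟩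

theorem isGivenBy_of_bounded {f : 𝓢'(Rn n, ℂ)} {F : Rn n → ℂ} (hF : Continuous F) {C : ℝ}
    (hC : ∀ x, ‖F x‖ ≤ C) (h : ∀ φ : 𝓢(Rn n, ℂ), f φ = ∫ x, φ x * F x) : IsGivenBy f F :=
  ⟨hF.locallyIntegrable, fun φ => ⟨φ.integrable.mul_bdd hF.aestronglyMeasurable
    (Filter.Eventually.of_forall hC), h φ⟩⟩

theorem IsGivenBy.ft {f : 𝓢'(Rn n, ℂ)} {F : Rn n → ℂ} (hf : IsGivenBy f F) (hF : Integrable F) :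
    IsGivenBy (ft f) (ftFun F) := by
  refine isGivenBy_of_bounded (continuous_ftFun hF) (norm_ftFun_le F) fun φ => ?_
  change f (schwartzFT n φ) = _
  rw [(hf.2 _).2, coe_schwartzFT, integral_ftFun_mul φ.integrable hF]

theorem IsGivenBy.ftInv {f : 𝓢'(Rn n, ℂ)} {F : Rn n → ℂ} (hf : IsGivenBy f F)
    (hF : Integrable F) : IsGivenBy (ftInv f) (ftInvFun F) := by
  refine isGivenBy_of_bounded (continuous_ftInvFun hF) (norm_ftInvFun_le F) fun φ => ?_
  change f (schwartzFTInv n φ) = _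
  rw [(hf.2 _).2, coe_schwartzFTInv, integral_ftInvFun_mul φ.integrable hF]

theorem IsGivenBy.ae_eq_ftInvFun {f : 𝓢'(Rn n, ℂ)} {F U : Rn n → ℂ} (hF : IsGivenBy f F)
    (hU : IsGivenBy (GaussianDecay.ft f) U) (hi : Integrable U) : F =ᵐ[volume] ftInvFun U := by
  have h := hU.ftInv hi
  rw [ftInv_ft] at h
  exact hF.ae_eq h

/-- Inversion is done on distributions, so `ftInvFun U` itself need not be integrable. -/
theorem IsGivenBy.ft_of_ftInvFun {f : 𝓢'(Rn n, ℂ)} {U : Rn n → ℂ} (hi : Integrable U)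
    (hf : IsGivenBy f (ftInvFun U)) : IsGivenBy (GaussianDecay.ft f) U := by
  obtain ⟨k, hk⟩ := exists_isGivenBy hi
  have h : f = GaussianDecay.ftInv k := by
    ext φ
    rw [(hf.2 φ).2, ((hk.ftInv hi).2 φ).2]
  rw [h, ft_ftInv]
  exact hk

theorem IsGivenBy.ft_ft {f : 𝓢'(Rn n, ℂ)} {F : Rn n → ℂ} (hF : IsGivenBy f F)
    (hi : Integrable F) : IsGivenBy (GaussianDecay.ft (GaussianDecay.ft f)) fun x => F (-x) := by
  have key : ∀ φ : 𝓢(Rn n, ℂ), ⇑(schwartzFT n (schwartzFT n φ)) = fun x => φ (-x) := by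
    intro φ
    funext x
    rw [coe_schwartzFT, coe_schwartzFT, ← ftInvFun_ftFun_schwartz φ,
      ftInvFun_eq_ftFun_neg, neg_neg, ftInvFun_ftFun_schwartz]
  refine ⟨?_, fun φ => ?_⟩
  · exact hi.comp_neg.locallyIntegrable
  · have h := hF.2 (schwartzFT n (schwartzFT n φ))
    rw [key] at h
    refine ⟨?_, ?_⟩
    · simpa using h.1.comp_neg
    · rw [← integral_neg_eq_self (fun x => φ x * F (-x))]
      simp only [neg_neg]
      exact h.2

/-! ### Plancherel -/

/-- The isometry on `Lp` concerns the abstract `L²` transform; pairing with Schwartz functions shows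
that it agrees almost everywhere with the integral. -/
theorem eLpNorm_fourier_eq {F : Rn n → ℂ} (hF : Integrable F) (hF2 : MemLp F 2) :
    eLpNorm (𝓕 F) 2 = eLpNorm F 2 := by
  let w : Lp ℂ 2 (volume : Measure (Rn n)) := hF2.toLp
  let w' : Lp ℂ 2 (volume : Measure (Rn n)) := 𝓕 w
  have h : 𝓕 (Lp.toTemperedDistribution w) = Lp.toTemperedDistribution w' :=
    Lp.fourier_toTemperedDistribution_eq w
  have hn : ‖w'‖ = ‖w‖ := Lp.norm_fourier_eq w
  have hae : 𝓕 F =ᵐ[volume] w' := by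
    have hc : Continuous (𝓕 F) := VectorFourier.fourierIntegral_continuous
      Real.continuous_fourierChar continuous_inner hF
    refine ae_eq_of_integral_schwartz_mul_eq hc.locallyIntegrable
      ((Lp.memLp _).locallyIntegrable one_le_two) fun φ => ?_
    have h2 := DFunLike.congr_fun h φ
    rw [TemperedDistribution.fourier_apply, Lp.toTemperedDistribution_apply,
      Lp.toTemperedDistribution_apply] at h2
    simp only [smul_eq_mul] at h2
    rw [← h2]
    have h3 := VectorFourier.integral_fourierIntegral_smul_eq_flip (μ := volume) (ν := volume)
      (L := innerₗ (Rn n)) Real.continuous_fourierChar continuous_inner φ.integrable hF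
    rw [flip_innerₗ] at h3
    refine h3.symm.trans (integral_congr_ae ?_)
    filter_upwards [hF2.coeFn_toLp] with x hx
    rw [hx, smul_eq_mul, SchwartzMap.fourier_coe]
    rfl
  rw [eLpNorm_congr_ae hae, ← Lp.enorm_def, ← eLpNorm_congr_ae hF2.coeFn_toLp, ← Lp.enorm_def,
    ← ofReal_norm, ← ofReal_norm]
  exact congrArg ENNReal.ofReal hn

theorem eLpNorm_two_sq (F : Rn n → ℂ) : eLpNorm F 2 ^ 2 = ∫⁻ x, ‖F x‖ₑ ^ 2 := by
  have h := eLpNorm_nnreal_pow_eq_lintegral (f := F) (μ := volume) (p := 2) two_ne_zero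
  simp only [NNReal.coe_ofNat, ENNReal.rpow_two] at h
  exact h

theorem lintegral_comp_inv_smul (f : Rn n → ℝ≥0∞) {R : ℝ} (hR : 0 < R) :
    ∫⁻ x, f (R⁻¹ • x) = ENNReal.ofReal (R ^ n) * ∫⁻ x, f x := by
  have h := lintegral_map_equiv (μ := (volume : Measure (Rn n))) f
    (Homeomorph.smulOfNeZero (R⁻¹) (inv_ne_zero hR.ne')).toMeasurableEquiv
  have h2 := Measure.map_addHaar_smul (volume : Measure (Rn n)) (inv_ne_zero hR.ne')
  rw [show ∫⁻ x, f (R⁻¹ • x) = ∫⁻ x, f ((Homeomorph.smulOfNeZero (R⁻¹)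
    (inv_ne_zero hR.ne')).toMeasurableEquiv x) from rfl, ← h]
  rw [show (Measure.map ((Homeomorph.smulOfNeZero (R⁻¹)
    (inv_ne_zero hR.ne')).toMeasurableEquiv) (volume : Measure (Rn n))) = _ from h2,
    lintegral_smul_measure, finrank_euclideanSpace_fin, inv_pow, inv_inv,
    abs_of_pos (by positivity), smul_eq_mul]

/-- The Plancherel theorem. -/
theorem lintegral_ftFun_sq {F : Rn n → ℂ} (hF : Integrable F) (hF2 : MemLp F 2) :
    ∫⁻ ξ, ‖ftFun F ξ‖ₑ ^ 2 = ∫⁻ x, ‖F x‖ₑ ^ 2 := by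
  have hpos : (0 : ℝ) < 2 * Real.pi := by positivity
  simp_rw [ftFun_eq_fourier, enorm_mul, mul_pow]
  rw [lintegral_const_mul' _ _ (by finiteness),
    lintegral_comp_inv_smul (fun x => ‖𝓕 F x‖ₑ ^ 2) hpos, ← eLpNorm_two_sq,
    eLpNorm_fourier_eq hF hF2, eLpNorm_two_sq, ← mul_assoc]
  have h : ‖normConst n‖ₑ ^ 2 * ENNReal.ofReal ((2 * Real.pi) ^ n) = 1 := by
    have h1 := congrArg (fun z : ℂ => ‖z‖ₑ) (normConst_sq_mul n)
    simp only [enorm_mul, enorm_one] at h1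
    rw [sq, ← h1]
    congr 1
    rw [← ofReal_norm, Complex.norm_real, Real.norm_of_nonneg (by positivity)]
  rw [h, one_mul]

theorem lintegral_ftInvFun_sq {F : Rn n → ℂ} (hF : Integrable F) (hF2 : MemLp F 2) :
    ∫⁻ ξ, ‖ftInvFun F ξ‖ₑ ^ 2 = ∫⁻ x, ‖F x‖ₑ ^ 2 := by
  simp_rw [ftInvFun_eq_ftFun_neg]
  rw [← lintegral_ftFun_sq hF hF2]
  exact lintegral_neg_eq_self (fun x => ‖ftFun F x‖ₑ ^ 2)

/-! ### Gaussian weights and weighted convolution -/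

theorem integrable_gaussian {κ : ℝ} (hκ : 0 < κ) :
    Integrable fun x : Rn n => Real.exp (-(κ * ‖x‖ ^ 2)) := by
  have h := (GaussianFourier.integrable_cexp_neg_mul_sq_norm_add (V := Rn n) (b := κ)
    (by simpa using hκ) 0 0).norm
  refine h.congr (Filter.Eventually.of_forall fun x => ?_)
  simp only [Complex.norm_exp]
  congr 1
  simp [← Complex.ofReal_pow]

theorem memLp_gaussian {κ : ℝ} (hκ : 0 < κ) {p : ℝ≥0∞} (hp : 1 ≤ p) :
    MemLp (fun x : Rn n => Real.exp (-(κ * ‖x‖ ^ 2))) p := by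
  have hm : AEStronglyMeasurable (fun x : Rn n => Real.exp (-(κ * ‖x‖ ^ 2))) volume := by fun_prop
  rcases eq_or_ne p ⊤ with rfl | hpt
  · refine memLp_top_of_bound hm 1 (Filter.Eventually.of_forall fun x => ?_)
    rw [Real.norm_of_nonneg (Real.exp_nonneg _), Real.exp_le_one_iff]
    nlinarith [mul_nonneg hκ.le (sq_nonneg ‖x‖)]
  · have hp0 : p ≠ 0 := (zero_lt_one.trans_le hp).ne'
    rw [← integrable_norm_rpow_iff hm hp0 hpt]
    refine (integrable_gaussian (mul_pos hκ (ENNReal.toReal_pos hp0 hpt))).congr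
      (Filter.Eventually.of_forall fun x => ?_)
    simp only
    rw [Real.norm_of_nonneg (Real.exp_nonneg _), ← Real.exp_mul]
    congr 1
    ring

/-- Hölder against `e^{-A|x|²}`, which lies in the conjugate `L^{q'}`. -/
theorem integrable_of_memLp_weight {F : Rn n → ℂ} {q : ℝ≥0∞} (hq : 1 ≤ q) {A : ℝ} (hA : 0 < A)
    (hF : MemLp (fun x => (Real.exp (A * ‖x‖ ^ 2) : ℂ) * F x) q) : Integrable F := by
  have hc := ENNReal.HolderConjugate.inv_one_sub_inv' hq
  have h1 : (1 : ℝ≥0∞) ≤ (1 - q⁻¹)⁻¹ := by simp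
  have h := MemLp.integrable_mul (memLp_gaussian (n := n) hA h1).ofReal hF
  refine h.congr (Filter.Eventually.of_forall fun x => ?_)
  change ((Real.exp (-(A * ‖x‖ ^ 2)) : ℝ) : ℂ) * ((Real.exp (A * ‖x‖ ^ 2) : ℂ) * F x) = F x
  rw [← mul_assoc, show ((Real.exp (-(A * ‖x‖ ^ 2)) : ℝ) : ℂ) * (Real.exp (A * ‖x‖ ^ 2) : ℂ) = 1 by
    rw [← Complex.ofReal_mul, ← Real.exp_add]; simp, one_mul]

theorem lintegral_gaussian_ne_top {κ : ℝ} (hκ : 0 < κ) :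
    ∫⁻ x : Rn n, ENNReal.ofReal (Real.exp (-(κ * ‖x‖ ^ 2))) ≠ ⊤ :=
  (integrable_gaussian hκ).lintegral_lt_top.ne

/-- Hölder with the Gaussian in the conjugate space. Translation invariance makes `K` independent of
the centre `z`, which will move with the convolution variable. -/
theorem exists_lintegral_mul_gaussian_le {κ s : ℝ} (hκ : 0 < κ) (hs : 1 ≤ s) :
    ∃ K : ℝ≥0∞, K ≠ ⊤ ∧ ∀ (c : Rn n → ℝ≥0∞) (_ : AEMeasurable c) (z : Rn n),
      ∫⁻ y, c y * ENNReal.ofReal (Real.exp (-(κ * ‖y - z‖ ^ 2))) ≤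
        K * (∫⁻ y, c y ^ s) ^ (1 / s) := by
  rcases hs.eq_or_lt with rfl | hs
  · refine ⟨1, by simp, fun c _ z => ?_⟩
    simp only [ENNReal.rpow_one, div_one, one_mul]
    refine lintegral_mono fun y => mul_le_of_le_one_right' ?_
    rw [ENNReal.ofReal_le_one, Real.exp_le_one_iff]
    nlinarith [mul_nonneg hκ.le (sq_nonneg ‖y - z‖)]
  · have hc := Real.HolderConjugate.conjExponent hs
    have hpos : 0 < s.conjExponent := hc.symm.pos
    refine ⟨(∫⁻ y : Rn n, ENNReal.ofReal (Real.exp (-((κ * s.conjExponent) * ‖y‖ ^ 2)))) ^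
      (1 / s.conjExponent), ?_, fun c hcm z => ?_⟩
    · exact ENNReal.rpow_ne_top_of_nonneg (by positivity)
        (lintegral_gaussian_ne_top (mul_pos hκ hpos))
    · rw [mul_comm]
      refine (ENNReal.lintegral_mul_le_Lp_mul_Lq volume hc hcm (by fun_prop)).trans_eq ?_
      congr 2
      rw [← lintegral_sub_right_eq_self
        (fun y : Rn n => ENNReal.ofReal (Real.exp (-((κ * s.conjExponent) * ‖y‖ ^ 2)))) z]
      refine lintegral_congr fun y => ?_
      rw [ENNReal.ofReal_rpow_of_nonneg (Real.exp_nonneg _) hpos.le, ← Real.exp_mul]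
      congr 2
      ring

theorem norm_sq_weight_identity {A B : ℝ} (hA : 0 < A) (hB : 0 < B) (x y : Rn n) :
    A * ‖y‖ ^ 2 + B * ‖x - y‖ ^ 2 =
      A * B / (A + B) * ‖x‖ ^ 2 + (A + B) * ‖y - (B / (A + B)) • x‖ ^ 2 := by
  rw [norm_sub_sq_real, norm_sub_sq_real, real_inner_smul_right, norm_smul, mul_pow,
    Real.norm_eq_abs, sq_abs, real_inner_comm y x]
  have : A + B ≠ 0 := by positivity
  field_simp
  ring

theorem lintegral_lintegral_mul_sub {a b : Rn n → ℝ≥0∞} (ha : AEMeasurable a)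
    (hb : AEMeasurable b) :
    ∫⁻ x, ∫⁻ y, a y * b (x - y) = (∫⁻ y, a y) * ∫⁻ y, b y := by
  rw [lintegral_lintegral_swap]
  · have : ∀ y, ∫⁻ x, a y * b (x - y) = a y * ∫⁻ x, b x := by
      intro y
      have hq : Measure.QuasiMeasurePreserving (fun x : Rn n => x - y) volume volume :=
        (measurePreserving_sub_right volume y).quasiMeasurePreserving
      have hb' : AEMeasurable (fun x => b (x - y)) volume := hb.comp_quasiMeasurePreserving hq
      rw [lintegral_const_mul'' _ hb', lintegral_sub_right_eq_self]
    simp_rw [this]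
    rw [lintegral_mul_const'' _ ha]
  · exact (ha.comp_quasiMeasurePreserving Measure.quasiMeasurePreserving_snd).mul
      (hb.comp_quasiMeasurePreserving
        (quasiMeasurePreserving_sub_of_right_invariant volume volume))

theorem enorm_weight_convolution_le {A B : ℝ} (hA : 0 < A) (hB : 0 < B) (u v : Rn n → ℂ)
    (x : Rn n) :
    ‖(Real.exp (A * B / (A + B) * ‖x‖ ^ 2) : ℂ) * ∫ y, u y * v (x - y)‖ₑ ≤
      ∫⁻ y, (‖(Real.exp (A * ‖y‖ ^ 2) : ℂ) * u y‖ₑ *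
        ‖(Real.exp (B * ‖x - y‖ ^ 2) : ℂ) * v (x - y)‖ₑ) *
        ENNReal.ofReal (Real.exp (-((A + B) * ‖y - (B / (A + B)) • x‖ ^ 2))) := by
  rw [← integral_const_mul]
  refine (enorm_integral_le_lintegral_enorm _).trans_eq (lintegral_congr fun y => ?_)
  have h : (Real.exp (A * B / (A + B) * ‖x‖ ^ 2) : ℂ) * (u y * v (x - y)) =
      ((Real.exp (A * ‖y‖ ^ 2) : ℂ) * u y) * ((Real.exp (B * ‖x - y‖ ^ 2) : ℂ) * v (x - y)) *
        (Real.exp (-((A + B) * ‖y - (B / (A + B)) • x‖ ^ 2)) : ℂ) := by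
    have e : A * B / (A + B) * ‖x‖ ^ 2 = A * ‖y‖ ^ 2 + B * ‖x - y‖ ^ 2 +
        -((A + B) * ‖y - (B / (A + B)) • x‖ ^ 2) := by
      rw [norm_sq_weight_identity hA hB]; ring
    rw [e, Real.exp_add, Real.exp_add]
    push_cast
    ring
  rw [h, enorm_mul, enorm_mul]
  congr 1
  rw [← ofReal_norm, Complex.norm_real, Real.norm_of_nonneg (Real.exp_nonneg _)]

/-- After the square is completed, the leftover Gaussian absorbs the inner integral. For `q = ∞` its
mass is the only extra factor; for finite `q`, Hölder in `y` leaves the convolution of two `L¹`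
functions, the `q`-th powers of the weighted inputs, and Tonelli finishes. -/
theorem memLp_weight_convolution {q : ℝ≥0∞} (hq : 1 ≤ q) {A B : ℝ} (hA : 0 < A) (hB : 0 < B)
    {u v : Rn n → ℂ} (hu : MemLp (fun x => (Real.exp (A * ‖x‖ ^ 2) : ℂ) * u x) q)
    (hv : MemLp (fun x => (Real.exp (B * ‖x‖ ^ 2) : ℂ) * v x) q) :
    MemLp (fun x => (Real.exp (A * B / (A + B) * ‖x‖ ^ 2) : ℂ) * ∫ y, u y * v (x - y)) q := by
  have hui := integrable_of_memLp_weight hq hA hu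
  have hvi := integrable_of_memLp_weight hq hB hv
  have hAB : 0 < A + B := by positivity
  have hm : AEStronglyMeasurable (fun x =>
      (Real.exp (A * B / (A + B) * ‖x‖ ^ 2) : ℂ) * ∫ y, u y * v (x - y)) volume := by
    refine AEStronglyMeasurable.mul (by fun_prop) ?_
    exact (hui.integrable_convolution (ContinuousLinearMap.mul ℝ ℂ) hvi).aestronglyMeasurable
  have hq0 : q ≠ 0 := (zero_lt_one.trans_le hq).ne'
  have hsub : ∀ x : Rn n, Measure.QuasiMeasurePreserving (fun y : Rn n => x - y) volume volume :=
    fun x => (Measure.measurePreserving_sub_left volume x).quasiMeasurePreserving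
  rcases eq_or_ne q ⊤ with rfl | hqt
  · set Mu := eLpNorm (fun x => (Real.exp (A * ‖x‖ ^ 2) : ℂ) * u x) ⊤ volume with hMu
    set Mv := eLpNorm (fun x => (Real.exp (B * ‖x‖ ^ 2) : ℂ) * v x) ⊤ volume with hMv
    have hau : ∀ᵐ y, ‖(Real.exp (A * ‖y‖ ^ 2) : ℂ) * u y‖ₑ ≤ Mu := by
      rw [hMu, eLpNorm_exponent_top]
      exact enorm_ae_le_eLpNormEssSup _ _
    have hav : ∀ᵐ y, ‖(Real.exp (B * ‖y‖ ^ 2) : ℂ) * v y‖ₑ ≤ Mv := by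
      rw [hMv, eLpNorm_exponent_top]
      exact enorm_ae_le_eLpNormEssSup _ _
    set W := ∫⁻ x : Rn n, ENNReal.ofReal (Real.exp (-((A + B) * ‖x‖ ^ 2)))
    have hW : W ≠ ⊤ := lintegral_gaussian_ne_top hAB
    have hfin : Mu * Mv * W ≠ ⊤ :=
      ENNReal.mul_ne_top (ENNReal.mul_ne_top hu.eLpNorm_ne_top hv.eLpNorm_ne_top) hW
    refine memLp_top_of_bound hm (Mu * Mv * W).toReal (Filter.Eventually.of_forall fun x => ?_)
    rw [← toReal_enorm]
    refine ENNReal.toReal_mono hfin ((enorm_weight_convolution_le hA hB u v x).trans ?_)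
    have hW' : W = ∫⁻ y : Rn n,
        ENNReal.ofReal (Real.exp (-((A + B) * ‖y - (B / (A + B)) • x‖ ^ 2))) :=
      (lintegral_sub_right_eq_self (fun y : Rn n =>
        ENNReal.ofReal (Real.exp (-((A + B) * ‖y‖ ^ 2)))) _).symm
    rw [hW', ← lintegral_const_mul _ (by fun_prop)]
    refine lintegral_mono_ae ?_
    filter_upwards [hau, (hsub x).ae hav] with y h1 h2
    gcongr
  · refine ⟨hm, ?_⟩
    set s := q.toReal with hs
    have hs1 : 1 ≤ s := by
      rw [hs, ← ENNReal.toReal_one]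
      exact ENNReal.toReal_mono hqt hq
    have hs0 : 0 < s := zero_lt_one.trans_le hs1
    obtain ⟨K, hK, hKle⟩ := exists_lintegral_mul_gaussian_le (n := n) hAB hs1
    rw [eLpNorm_lt_top_iff_lintegral_rpow_enorm_lt_top hq0 hqt]
    have hu' := (eLpNorm_lt_top_iff_lintegral_rpow_enorm_lt_top hq0 hqt).1 hu.2
    have hv' := (eLpNorm_lt_top_iff_lintegral_rpow_enorm_lt_top hq0 hqt).1 hv.2
    have hum := hu.1.enorm
    have hvm := hv.1.enorm
    have hb : ∀ x : Rn n, ‖(Real.exp (A * B / (A + B) * ‖x‖ ^ 2) : ℂ) *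
        ∫ y, u y * v (x - y)‖ₑ ^ s ≤ K ^ s * ∫⁻ y, ‖(Real.exp (A * ‖y‖ ^ 2) : ℂ) * u y‖ₑ ^ s *
        ‖(Real.exp (B * ‖x - y‖ ^ 2) : ℂ) * v (x - y)‖ₑ ^ s := by
      intro x
      have h := (enorm_weight_convolution_le hA hB u v x).trans
        (hKle _ (hum.mul (hvm.comp_quasiMeasurePreserving (hsub x))) _)
      refine (ENNReal.rpow_le_rpow h hs0.le).trans_eq ?_
      rw [ENNReal.mul_rpow_of_nonneg _ _ hs0.le, ← ENNReal.rpow_mul, one_div,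
        inv_mul_cancel₀ hs0.ne', ENNReal.rpow_one]
      congr 1
      exact lintegral_congr fun y => ENNReal.mul_rpow_of_nonneg _ _ hs0.le
    refine (lintegral_mono hb).trans_lt ?_
    have hKs : K ^ s ≠ ⊤ := ENNReal.rpow_ne_top_of_nonneg hs0.le hK
    rw [lintegral_const_mul' _ _ hKs,
      lintegral_lintegral_mul_sub (a := fun y => ‖(Real.exp (A * ‖y‖ ^ 2) : ℂ) * u y‖ₑ ^ s)
        (b := fun y => ‖(Real.exp (B * ‖y‖ ^ 2) : ℂ) * v y‖ₑ ^ s)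
        (hum.pow_const s) (hvm.pow_const s)]
    exact ENNReal.mul_lt_top hKs.lt_top (ENNReal.mul_lt_top hu' hv')

/-! ### Duality, products and convolutions -/

theorem normConst_ne_zero (n : ℕ) : normConst n ≠ 0 := by
  intro h
  simpa [h] using normConst_sq_mul n

theorem ftFun_convolution {u v : Rn n → ℂ} (hu : Integrable u) (hv : Integrable v) (ξ : Rn n) :
    ftFun (fun x => ∫ y, u y * v (x - y)) ξ = (normConst n)⁻¹ * (ftFun u ξ * ftFun v ξ) := by
  have h : 𝓕 (fun x => ∫ y, u y * v (x - y)) ((2 * Real.pi)⁻¹ • ξ) =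
      𝓕 u ((2 * Real.pi)⁻¹ • ξ) * 𝓕 v ((2 * Real.pi)⁻¹ • ξ) :=
    Real.fourier_mul_convolution_eq hu hv ((2 * Real.pi)⁻¹ • ξ)
  have hc := normConst_ne_zero n
  simp only [ftFun_eq_fourier, h]
  field_simp

theorem ftInvFun_convolution {u v : Rn n → ℂ} (hu : Integrable u) (hv : Integrable v)
    (x : Rn n) :
    ftInvFun (fun x => ∫ y, u y * v (x - y)) x =
      (normConst n)⁻¹ * (ftInvFun u x * ftInvFun v x) := by
  simp only [ftInvFun_eq_ftFun_neg]
  exact ftFun_convolution hu hv _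

theorem integrable_convolution {u v : Rn n → ℂ} (hu : Integrable u) (hv : Integrable v) :
    Integrable fun x => ∫ y, u y * v (x - y) :=
  hu.integrable_convolution (ContinuousLinearMap.mul ℝ ℂ) hv

theorem ae_integrable_convolution {u v : Rn n → ℂ} (hu : Integrable u) (hv : Integrable v) :
    ∀ᵐ x : Rn n, Integrable fun y => u y * v (x - y) :=
  hu.ae_convolution_exists (ContinuousLinearMap.mul ℝ ℂ) hv

/-- Hölder for the triple `(p, r, l)`, valid also when `l < 1`. -/
theorem memLp_weight_mul {p r l : ℝ≥0∞} (hl : 1 / p + 1 / r = 1 / l) {A B : ℝ}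
    {u v : Rn n → ℂ} (hu : MemLp (fun x => (Real.exp (A * ‖x‖ ^ 2) : ℂ) * u x) p)
    (hv : MemLp (fun x => (Real.exp (B * ‖x‖ ^ 2) : ℂ) * v x) r) :
    MemLp (fun x => (Real.exp ((A + B) * ‖x‖ ^ 2) : ℂ) * (u x * v x)) l := by
  have : ENNReal.HolderTriple p r l := ⟨by simpa [one_div] using hl⟩
  refine (hv.mul hu).ae_eq (Filter.Eventually.of_forall fun x => ?_)
  simp only [Pi.mul_apply, add_mul, Real.exp_add]
  push_cast
  ring

theorem memLp_weight_congr {p : ℝ≥0∞} {A : ℝ} {u v : Rn n → ℂ} (h : u =ᵐ[volume] v)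
    (hu : MemLp (fun x => (Real.exp (A * ‖x‖ ^ 2) : ℂ) * u x) p) :
    MemLp (fun x => (Real.exp (A * ‖x‖ ^ 2) : ℂ) * v x) p := by
  refine hu.ae_eq ?_
  filter_upwards [h] with x hx
  rw [hx]

theorem memLp_weight_const_mul {p : ℝ≥0∞} {A : ℝ} {u : Rn n → ℂ} (c : ℂ)
    (hu : MemLp (fun x => (Real.exp (A * ‖x‖ ^ 2) : ℂ) * u x) p) :
    MemLp (fun x => (Real.exp (A * ‖x‖ ^ 2) : ℂ) * (c * u x)) p := by
  refine (hu.const_mul c).ae_eq (Filter.Eventually.of_forall fun x => ?_)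
  simp only
  ring

theorem memLp_weight_comp_neg {p : ℝ≥0∞} {A : ℝ} {u : Rn n → ℂ}
    (hu : MemLp (fun x => (Real.exp (A * ‖x‖ ^ 2) : ℂ) * u x) p) :
    MemLp (fun x => (Real.exp (A * ‖x‖ ^ 2) : ℂ) * u (-x)) p := by
  have h := hu.comp_measurePreserving (Measure.measurePreserving_neg volume)
  refine h.ae_eq (Filter.Eventually.of_forall fun x => ?_)
  simp

theorem ae_eq_comp_neg {u v : Rn n → ℂ} (h : u =ᵐ[volume] v) :
    (fun x => u (-x)) =ᵐ[volume] fun x => v (-x) :=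
  (Measure.measurePreserving_neg volume).quasiMeasurePreserving.ae h

theorem ae_eq_convolution {u v u' v' : Rn n → ℂ} (hu : u =ᵐ[volume] u') (hv : v =ᵐ[volume] v')
    (x : Rn n) : ∫ y, u y * v (x - y) = ∫ y, u' y * v' (x - y) := by
  refine integral_congr_ae ?_
  filter_upwards [hu, (Measure.measurePreserving_sub_left volume x).quasiMeasurePreserving.ae hv]
    with y h1 h2
  rw [h1, h2]

/-- The double transform is reflection, under which the weight is invariant. -/
theorem IsO.ft {p q : ℝ≥0∞} (hp : 1 ≤ p) {A₁ A₂ : ℝ} (hA₁ : 0 < A₁) {f : 𝓢'(Rn n, ℂ)}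
    (hf : IsO p q A₁ A₂ f) : IsO q p A₂ A₁ (ft f) := by
  refine ⟨hf.2, ?_⟩
  obtain ⟨F, hF, hw⟩ := hf.1
  exact ⟨_, hF.ft_ft (integrable_of_memLp_weight hp hA₁ hw), memLp_weight_comp_neg hw⟩

/-- One factor is integrable and the other, an inverse transform of an integrable function, is
bounded; hence the product is integrable even when `l < 1`. -/
theorem exists_isProduct {p q r : ℝ≥0∞} (hp : 1 ≤ p) (hq : 1 ≤ q) {A₁ A₂ B₁ B₂ : ℝ}
    (hA₁ : 0 < A₁) (hB₂ : 0 < B₂) {f g : 𝓢'(Rn n, ℂ)} (hf : IsO p q A₁ A₂ f)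
    (hg : IsO r q B₁ B₂ g) : ∃ k, IsProduct f g k := by
  obtain ⟨⟨F, hF, hFw⟩, -⟩ := hf
  obtain ⟨⟨G, hG, -⟩, ⟨V, hV, hVw⟩⟩ := hg
  have hFi := integrable_of_memLp_weight hp hA₁ hFw
  have hVi := integrable_of_memLp_weight hq hB₂ hVw
  have hG' := hG.congr (hG.ae_eq_ftInvFun hV hVi)
  have hi : Integrable fun x => F x * ftInvFun V x :=
    hFi.mul_bdd (continuous_ftInvFun hVi).aestronglyMeasurable
      (Filter.Eventually.of_forall (norm_ftInvFun_le V))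
  obtain ⟨k, hk⟩ := exists_isGivenBy hi
  exact ⟨k, F, _, hF, hG', hk⟩

/-- The transform of the product is the normalized convolution of the transforms: it is integrable,
and its inverse transform is the product almost everywhere. -/
theorem IsProduct.isO {p q r l : ℝ≥0∞} (hq : 1 ≤ q)
    (hl : 1 / p + 1 / r = 1 / l) {A₁ A₂ B₁ B₂ : ℝ} (hA₂ : 0 < A₂) (hB₂ : 0 < B₂)
    {f g k : 𝓢'(Rn n, ℂ)} (hk : IsProduct f g k) (hf : IsO p q A₁ A₂ f)
    (hg : IsO r q B₁ B₂ g) : IsO l q (A₁ + B₁) (A₂ * B₂ / (A₂ + B₂)) k := by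
  obtain ⟨⟨F, hF, hFw⟩, ⟨U, hU, hUw⟩⟩ := hf
  obtain ⟨⟨G, hG, hGw⟩, ⟨V, hV, hVw⟩⟩ := hg
  obtain ⟨F', G', hF', hG', hk⟩ := hk
  have hUi := integrable_of_memLp_weight hq hA₂ hUw
  have hVi := integrable_of_memLp_weight hq hB₂ hVw
  refine ⟨⟨_, hk, memLp_weight_mul hl (memLp_weight_congr (hF.ae_eq hF') hFw)
    (memLp_weight_congr (hG.ae_eq hG') hGw)⟩,
    ⟨fun x => normConst n * ∫ y, U y * V (x - y), ?_,
      memLp_weight_const_mul _ (memLp_weight_convolution hq hA₂ hB₂ hUw hVw)⟩⟩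
  refine IsGivenBy.ft_of_ftInvFun ((integrable_convolution hUi hVi).const_mul _) (hk.congr ?_)
  filter_upwards [hF'.ae_eq_ftInvFun hU hUi, hG'.ae_eq_ftInvFun hV hVi] with x h1 h2
  have h3 := ftInvFun_convolution hUi hVi x
  have h4 : ftInvFun (fun x => normConst n * ∫ y, U y * V (x - y)) x =
      normConst n * ftInvFun (fun x => ∫ y, U y * V (x - y)) x := by
    simp only [ftInvFun, mul_left_comm _ (normConst n), integral_const_mul]
  rw [h4, h3, h1, h2, mul_inv_cancel_left₀ (normConst_ne_zero n)]

theorem exists_isConvolution {p q r : ℝ≥0∞} (hq : 1 ≤ q) {A₁ A₂ B₁ B₂ : ℝ}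
    (hA₁ : 0 < A₁) (hB₁ : 0 < B₁) {f g : 𝓢'(Rn n, ℂ)} (hf : IsO q p A₁ A₂ f)
    (hg : IsO q r B₁ B₂ g) : ∃ k, IsConvolution g f k := by
  obtain ⟨⟨F, hF, hFw⟩, -⟩ := hf
  obtain ⟨⟨G, hG, hGw⟩, -⟩ := hg
  have hFi := integrable_of_memLp_weight hq hA₁ hFw
  have hGi := integrable_of_memLp_weight hq hB₁ hGw
  obtain ⟨k, hk⟩ := exists_isGivenBy (integrable_convolution hGi hFi)
  exact ⟨k, G, F, hG, hF, ae_integrable_convolution hGi hFi, hk⟩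

theorem IsConvolution.isO {p q r l : ℝ≥0∞} (hq : 1 ≤ q)
    (hl : 1 / p + 1 / r = 1 / l) {A₁ A₂ B₁ B₂ : ℝ} (hA₁ : 0 < A₁) (hB₁ : 0 < B₁)
    {f g k : 𝓢'(Rn n, ℂ)} (hk : IsConvolution g f k) (hf : IsO q p A₁ A₂ f)
    (hg : IsO q r B₁ B₂ g) : IsO q l (A₁ * B₁ / (A₁ + B₁)) (A₂ + B₂) k := by
  obtain ⟨⟨F, hF, hFw⟩, ⟨U, hU, hUw⟩⟩ := hf
  obtain ⟨⟨G, hG, hGw⟩, ⟨V, hV, hVw⟩⟩ := hg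
  obtain ⟨G', F', hG', hF', -, hk⟩ := hk
  have hFi := integrable_of_memLp_weight hq hA₁ hFw
  have hGi := integrable_of_memLp_weight hq hB₁ hGw
  have hk' : IsGivenBy k fun x => ∫ y, G y * F (x - y) :=
    hk.congr (Filter.Eventually.of_forall fun x => ae_eq_convolution (hG'.ae_eq hG)
      (hF'.ae_eq hF) x)
  refine ⟨⟨_, hk', ?_⟩, ⟨_, hk'.ft (integrable_convolution hGi hFi), ?_⟩⟩
  · rw [mul_comm A₁, add_comm A₁]
    exact memLp_weight_convolution hq hB₁ hA₁ hGw hFw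
  · have hUF := memLp_weight_congr (hU.ae_eq (hF.ft hFi)) hUw
    have hVG := memLp_weight_congr (hV.ae_eq (hG.ft hGi)) hVw
    simp only [ftFun_convolution hGi hFi]
    refine memLp_weight_const_mul _ ?_
    simp only [mul_comm (ftFun G _)]
    exact memLp_weight_mul hl hUF hVG

/-! ### Complex Gaussians, exponential tilts and contour shifts -/

theorem ofReal_norm_sq_eq_sum (x : Rn n) : ((‖x‖ ^ 2 : ℝ) : ℂ) = ∑ i, (x i : ℂ) ^ 2 := by
  rw [EuclideanSpace.norm_sq_eq]
  push_cast
  refine Finset.sum_congr rfl fun i _ => ?_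
  rw [← Complex.ofReal_pow, Real.norm_eq_abs, sq_abs, Complex.ofReal_pow]

theorem ofReal_inner_eq_sum (x y : Rn n) : ((inner ℝ x y : ℝ) : ℂ) = ∑ i, (x i : ℂ) * y i := by
  simp [PiLp.inner_apply, mul_comm]

theorem integrable_cexp_quadratic_form {b : ℂ} (hb : 0 < b.re) (c : Fin n → ℂ) :
    Integrable fun x : Rn n => Complex.exp (-b * (‖x‖ ^ 2 : ℝ) + ∑ i, c i * (x i : ℂ)) := by
  rw [← (PiLp.volume_preserving_toLp (Fin n)).integrable_comp_emb
    (MeasurableEquiv.toLp 2 _).measurableEmbedding]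
  simp only [ofReal_norm_sq_eq_sum]
  exact GaussianFourier.integrable_cexp_neg_mul_sum_add hb c

theorem integral_cexp_quadratic_form {b : ℂ} (hb : 0 < b.re) (c : Fin n → ℂ) :
    ∫ x : Rn n, Complex.exp (-b * (‖x‖ ^ 2 : ℝ) + ∑ i, c i * (x i : ℂ)) =
      (Real.pi / b) ^ (n / 2 : ℂ) * Complex.exp ((∑ i, c i ^ 2) / (4 * b)) := by
  rw [← (PiLp.volume_preserving_toLp (Fin n)).integral_comp
    (MeasurableEquiv.toLp 2 _).measurableEmbedding]
  simp only [ofReal_norm_sq_eq_sum]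
  simpa using GaussianFourier.integral_cexp_neg_mul_sum_add hb c

/-- The value `-b (x + iν)² + μ·(x + iν)` of a quadratic polynomial at the complex point
`x + iν`. -/
def shiftExp (b : ℂ) (μ ν x : Rn n) : ℂ :=
  -b * ((‖x‖ ^ 2 : ℝ) - (‖ν‖ ^ 2 : ℝ) + 2 * Complex.I * (inner ℝ x ν : ℝ)) +
    (inner ℝ μ x : ℝ) + Complex.I * (inner ℝ μ ν : ℝ)

theorem shiftExp_eq (b : ℂ) (μ ν x : Rn n) :
    shiftExp b μ ν x = (b * (‖ν‖ ^ 2 : ℝ) + Complex.I * (inner ℝ μ ν : ℝ)) +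
      (-b * (‖x‖ ^ 2 : ℝ) + ∑ i, (μ i - 2 * Complex.I * b * ν i) * (x i : ℂ)) := by
  simp only [shiftExp, sub_mul, Finset.sum_sub_distrib, mul_assoc, ← Finset.mul_sum,
    ← ofReal_inner_eq_sum]
  rw [real_inner_comm ν x]
  ring

theorem continuous_shiftExp (b : ℂ) (μ ν : Rn n) : Continuous (shiftExp b μ ν) := by
  unfold shiftExp
  fun_prop

theorem integrable_cexp_shiftExp {b : ℂ} (hb : 0 < b.re) (μ ν : Rn n) :
    Integrable fun x => Complex.exp (shiftExp b μ ν x) := by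
  simp only [shiftExp_eq, Complex.exp_add (b * _ + _)]
  exact (integrable_cexp_quadratic_form hb _).const_mul _

theorem memLp_two_cexp_shiftExp {b : ℂ} (hb : 0 < b.re) (μ ν : Rn n) :
    MemLp (fun x => Complex.exp (shiftExp b μ ν x)) 2 := by
  rw [memLp_two_iff_integrable_sq_norm
    (continuous_shiftExp b μ ν).cexp.aestronglyMeasurable]
  have hb2 : 0 < (2 * b).re := by simpa using hb
  refine (integrable_cexp_shiftExp hb2 ((2 : ℝ) • μ) ν).norm.congr
    (Filter.Eventually.of_forall fun x => ?_)
  simp only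
  rw [← norm_pow, ← Complex.exp_nat_mul]
  congr 2
  simp only [shiftExp, real_inner_smul_left]
  push_cast
  ring

theorem re_shiftExp (b : ℂ) (μ ν x : Rn n) : (shiftExp b μ ν x).re =
    -b.re * (‖x‖ ^ 2 - ‖ν‖ ^ 2) + 2 * b.im * inner ℝ x ν + inner ℝ μ x := by
  simp [shiftExp, -Complex.ofReal_pow]
  ring

/-- Both sides are evaluated in closed form, so no Cauchy theorem is needed to move the contour. -/
theorem integral_cexp_shiftExp_add {b : ℂ} (hb : 0 < b.re) (μ ν ζ : Rn n) :
    ∫ x, Complex.exp (shiftExp b μ ν x + Complex.I * (inner ℝ x ζ : ℝ)) =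
      Complex.exp ((inner ℝ ν ζ : ℝ)) *
        ∫ x, Complex.exp (shiftExp b μ 0 x + Complex.I * (inner ℝ x ζ : ℝ)) := by
  have key : ∀ ν : Rn n, ∫ x, Complex.exp (shiftExp b μ ν x + Complex.I * (inner ℝ x ζ : ℝ)) =
      Complex.exp ((inner ℝ ν ζ : ℝ)) * ((Real.pi / b) ^ (n / 2 : ℂ) *
        Complex.exp ((∑ i, (μ i + Complex.I * ζ i) ^ 2) / (4 * b))) := by
    intro ν
    have h : ∀ x : Rn n, shiftExp b μ ν x + Complex.I * (inner ℝ x ζ : ℝ) =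
        (b * (‖ν‖ ^ 2 : ℝ) + Complex.I * (inner ℝ μ ν : ℝ)) + (-b * (‖x‖ ^ 2 : ℝ) +
          ∑ i, (μ i + Complex.I * ζ i - 2 * Complex.I * b * ν i) * (x i : ℂ)) := by
      intro x
      rw [shiftExp_eq]
      simp only [sub_mul, add_mul, Finset.sum_sub_distrib, Finset.sum_add_distrib, mul_assoc,
        ← Finset.mul_sum, ← ofReal_inner_eq_sum]
      rw [real_inner_comm ζ x]
      ring
    simp only [h, Complex.exp_add (b * _ + _), integral_const_mul,
      integral_cexp_quadratic_form hb]
    rw [mul_left_comm, ← Complex.exp_add, mul_left_comm, ← Complex.exp_add]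
    congr 2
    have hb0 : b ≠ 0 := by
      rintro rfl
      simp at hb
    have e : ∑ i, (μ i + Complex.I * ζ i - 2 * Complex.I * b * ν i) ^ 2 =
        ∑ i, (μ i + Complex.I * ζ i) ^ 2 - 4 * Complex.I * b * (inner ℝ μ ν : ℝ) +
          4 * b * (inner ℝ ν ζ : ℝ) - 4 * b ^ 2 * (‖ν‖ ^ 2 : ℝ) := by
      simp only [ofReal_inner_eq_sum, ofReal_norm_sq_eq_sum, Finset.mul_sum,
        ← Finset.sum_sub_distrib, ← Finset.sum_add_distrib]
      refine Finset.sum_congr rfl fun i _ => ?_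
      linear_combination (-4 * b * ν i * ζ i + 4 * b ^ 2 * (ν i) ^ 2 : ℂ) * Complex.I_sq
    rw [e]
    field_simp
    ring
  rw [key ν, key 0]
  simp

/-- The function `x ↦ e^{μ·x} F(x)`. -/
def tilt (μ : Rn n) (F : Rn n → ℂ) (x : Rn n) : ℂ := (Real.exp (inner ℝ μ x) : ℂ) * F x

theorem tilt_zero (F : Rn n → ℂ) : tilt 0 F = F := by
  funext x
  simp [tilt]

/-- Half of the Gaussian weight absorbs the linear one: `μ·x ≤ A|x|²/2 + |μ|²/(2A)`. -/
theorem memLp_weight_tilt {A : ℝ} (hA : 0 < A) (μ : Rn n) {F : Rn n → ℂ}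
    (hF : MemLp (fun x => (Real.exp (A * ‖x‖ ^ 2) : ℂ) * F x) 2) :
    MemLp (fun x => (Real.exp (A / 2 * ‖x‖ ^ 2) : ℂ) * tilt μ F x) 2 := by
  have hm : AEStronglyMeasurable F volume :=
    (integrable_of_memLp_weight one_le_two hA hF).aestronglyMeasurable
  refine MemLp.of_le_mul (c := Real.exp (‖μ‖ ^ 2 / (2 * A))) hF
    (AEStronglyMeasurable.mul (by fun_prop) (AEStronglyMeasurable.mul (by fun_prop) hm))
    (Filter.Eventually.of_forall fun x => ?_)
  simp only [tilt, norm_mul, Complex.norm_real, Real.norm_of_nonneg (Real.exp_nonneg _),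
    ← mul_assoc, ← Real.exp_add]
  refine mul_le_mul_of_nonneg_right (Real.exp_le_exp.2 ?_) (norm_nonneg _)
  have h1 : inner ℝ μ x ≤ ‖μ‖ * ‖x‖ := real_inner_le_norm μ x
  have h2 : ‖μ‖ ^ 2 / (2 * A) + A / 2 * ‖x‖ ^ 2 - ‖μ‖ * ‖x‖ =
      (‖μ‖ - A * ‖x‖) ^ 2 / (2 * A) := by
    field_simp
    ring
  have h3 : 0 ≤ (‖μ‖ - A * ‖x‖) ^ 2 / (2 * A) := by positivity
  nlinarith

theorem integrable_tilt {A : ℝ} (hA : 0 < A) (μ : Rn n) {F : Rn n → ℂ}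
    (hF : MemLp (fun x => (Real.exp (A * ‖x‖ ^ 2) : ℂ) * F x) 2) : Integrable (tilt μ F) :=
  integrable_of_memLp_weight one_le_two (half_pos hA) (memLp_weight_tilt hA μ hF)

theorem memLp_two_of_weight {A : ℝ} (hA : 0 ≤ A) {F : Rn n → ℂ}
    (hm : AEStronglyMeasurable F volume)
    (hF : MemLp (fun x => (Real.exp (A * ‖x‖ ^ 2) : ℂ) * F x) 2) : MemLp F 2 := by
  refine hF.of_le hm (Filter.Eventually.of_forall fun x => ?_)
  rw [norm_mul, Complex.norm_real, Real.norm_of_nonneg (Real.exp_nonneg _)]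
  refine le_mul_of_one_le_left (norm_nonneg _) (Real.one_le_exp (by positivity))

theorem memLp_two_tilt {A : ℝ} (hA : 0 < A) (μ : Rn n) {F : Rn n → ℂ}
    (hF : MemLp (fun x => (Real.exp (A * ‖x‖ ^ 2) : ℂ) * F x) 2) : MemLp (tilt μ F) 2 :=
  memLp_two_of_weight (half_pos hA).le (integrable_tilt hA μ hF).aestronglyMeasurable
    (memLp_weight_tilt hA μ hF)

theorem enorm_tilt_sq (μ : Rn n) (F : Rn n → ℂ) (x : Rn n) :
    ‖tilt μ F x‖ₑ ^ 2 = ENNReal.ofReal (Real.exp (2 * inner ℝ μ x)) * ‖F x‖ₑ ^ 2 := by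
  rw [tilt, enorm_mul, mul_pow, ← ofReal_norm (Real.exp _ : ℂ), Complex.norm_real,
    Real.norm_of_nonneg (Real.exp_nonneg _), ← ENNReal.ofReal_pow (Real.exp_nonneg _),
    ← Real.exp_nat_mul]
  norm_num

/-- Shifting the contour of integration by `iν`. -/
theorem ftFun_shift {g : Rn n → ℂ} {ν : Rn n} (hg : Integrable g)
    (hgt : Integrable (tilt (-ν) g)) {b : ℂ} (hb : 0 < b.re) (μ ξ : Rn n) :
    ftFun (fun x => Complex.exp (shiftExp b μ ν x) * ftInvFun (tilt (-ν) g) x) ξ =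
      tilt (-ν) (ftFun fun x => Complex.exp (shiftExp b μ 0 x) * ftInvFun g x) ξ := by
  -- Passing the inverse transform onto the explicit Gaussian means that only the Gaussian has to be
  -- shifted; the continuation of `ftInvFun g` is encoded by the tilt of `g`.
  have key : ∀ {ν : Rn n} {G : Rn n → ℂ}, Integrable G →
      ftFun (fun x => Complex.exp (shiftExp b μ ν x) * ftInvFun G x) ξ =
      normConst n * ∫ η, G η * (normConst n *
        ∫ x, Complex.exp (shiftExp b μ ν x + Complex.I * (inner ℝ x (η - ξ) : ℝ))) := by
    intro ν G hG
    have hi : Integrable fun x : Rn n =>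
        Complex.exp (-(Complex.I * (inner ℝ x ξ : ℝ))) * Complex.exp (shiftExp b μ ν x) := by
      refine (integrable_cexp_shiftExp hb μ ν).bdd_mul (c := 1)
        (by fun_prop) (Filter.Eventually.of_forall fun x => ?_)
      simp [Complex.norm_exp]
    have h := integral_ftInvFun_mul hG hi
    rw [ftFun]
    congr 1
    have e1 : ∀ x, Complex.exp (-(Complex.I * (inner ℝ x ξ : ℝ))) *
        (Complex.exp (shiftExp b μ ν x) * ftInvFun G x) = ftInvFun G x *
        (Complex.exp (-(Complex.I * (inner ℝ x ξ : ℝ))) * Complex.exp (shiftExp b μ ν x)) :=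
      fun x => by ring
    simp only [e1]
    rw [h]
    refine integral_congr_ae (Filter.Eventually.of_forall fun η => ?_)
    simp only [ftInvFun]
    congr 3
    funext x
    rw [← Complex.exp_add, ← Complex.exp_add]
    congr 1
    rw [inner_sub_right]
    push_cast
    ring
  have hη : ∀ η, tilt (-ν) g η * (normConst n *
      ∫ x, Complex.exp (shiftExp b μ ν x + Complex.I * (inner ℝ x (η - ξ) : ℝ))) =
      (Real.exp (inner ℝ (-ν) ξ) : ℂ) * (g η * (normConst n *
        ∫ x, Complex.exp (shiftExp b μ 0 x + Complex.I * (inner ℝ x (η - ξ) : ℝ)))) := by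
    intro η
    have e : (Real.exp (inner ℝ (-ν) η) : ℂ) * Complex.exp ((inner ℝ ν (η - ξ) : ℝ)) =
        (Real.exp (inner ℝ (-ν) ξ) : ℂ) := by
      rw [← Complex.ofReal_exp, ← Complex.ofReal_mul, ← Real.exp_add]
      congr 2
      rw [inner_neg_left, inner_sub_right, inner_neg_left]
      ring
    rw [integral_cexp_shiftExp_add hb μ ν, tilt, ← e]
    ring
  rw [key hgt, tilt, key hg]
  simp only [hη]
  rw [integral_const_mul]
  ring

theorem integrable_cexp_shiftExp_mul {g : Rn n → ℂ} (hg : Integrable g) {b : ℂ}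
    (hb : 0 < b.re) (μ ν : Rn n) :
    Integrable fun x => Complex.exp (shiftExp b μ ν x) * ftInvFun g x :=
  (integrable_cexp_shiftExp hb μ ν).mul_bdd (continuous_ftInvFun hg).aestronglyMeasurable
    (Filter.Eventually.of_forall (norm_ftInvFun_le g))

theorem memLp_two_cexp_shiftExp_mul {g : Rn n → ℂ} (hg : Integrable g) {b : ℂ}
    (hb : 0 < b.re) (μ ν : Rn n) :
    MemLp (fun x => Complex.exp (shiftExp b μ ν x) * ftInvFun g x) 2 := by
  refine MemLp.of_le_mul (c := ‖normConst n‖ * ∫ x, ‖g x‖) (memLp_two_cexp_shiftExp hb μ ν)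
    (integrable_cexp_shiftExp_mul hg hb μ ν).aestronglyMeasurable
    (Filter.Eventually.of_forall fun x => ?_)
  rw [norm_mul, mul_comm]
  gcongr
  exact norm_ftInvFun_le g x

theorem enorm_cexp_sq (z : ℂ) : ‖Complex.exp z‖ₑ ^ 2 = ENNReal.ofReal (Real.exp (2 * z.re)) := by
  rw [← ofReal_norm, Complex.norm_exp, ← ENNReal.ofReal_pow (Real.exp_nonneg _),
    ← Real.exp_nat_mul]
  norm_num

/-- The Plancherel theorem after a shift of the contour of integration by `iν`. -/
theorem lintegral_tilt_ftFun_sq {g : Rn n → ℂ} {ν : Rn n} (hg : Integrable g)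
    (hgt : Integrable (tilt (-ν) g)) {b : ℂ} (hb : 0 < b.re) (μ : Rn n) :
    ∫⁻ ξ, ‖tilt (-ν) (ftFun fun x => Complex.exp (shiftExp b μ 0 x) * ftInvFun g x) ξ‖ₑ ^ 2 =
      ∫⁻ x, ENNReal.ofReal (Real.exp (2 * (shiftExp b μ ν x).re)) *
        ‖ftInvFun (tilt (-ν) g) x‖ₑ ^ 2 := by
  simp only [← ftFun_shift hg hgt hb μ]
  rw [lintegral_ftFun_sq (integrable_cexp_shiftExp_mul hgt hb μ ν)
    (memLp_two_cexp_shiftExp_mul hgt hb μ ν)]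
  simp only [enorm_mul, mul_pow, enorm_cexp_sq]

theorem measurable_tilt_ftFun (μ : Rn n) {F : Rn n → ℂ} (hF : Integrable F) :
    Measurable fun ξ => ‖tilt μ (ftFun F) ξ‖ₑ ^ 2 := by
  have h : Continuous (tilt μ (ftFun F)) := by
    unfold tilt
    exact (by fun_prop : Continuous fun x : Rn n => (Real.exp (inner ℝ μ x) : ℂ)).mul
      (continuous_ftFun hF)
  exact h.measurable.enorm.pow_const 2

/-! ### Interpolation between linear weights -/

/-- Hölder with exponents `1/θ` and `1/(1-θ)`: the tilted norm is log-convex along a ray. -/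
theorem lintegral_tilt_sq_le_interpolate {F : Rn n → ℂ} (hF : AEStronglyMeasurable F volume)
    {θ : ℝ} (h0 : 0 < θ) (h1 : θ < 1) (μ : Rn n) :
    ∫⁻ x, ‖tilt (θ • μ) F x‖ₑ ^ 2 ≤
      (∫⁻ x, ‖tilt μ F x‖ₑ ^ 2) ^ θ * (∫⁻ x, ‖F x‖ₑ ^ 2) ^ (1 - θ) := by
  have hm : AEMeasurable (fun x => ‖tilt μ F x‖ₑ ^ 2) volume := by
    unfold tilt
    exact (AEStronglyMeasurable.mul (by fun_prop) hF).enorm.pow_const 2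
  have h := ENNReal.lintegral_mul_norm_pow_le hm (hF.enorm.pow_const 2) h0.le
    (sub_pos.2 h1).le (add_sub_cancel θ 1)
  refine le_of_eq_of_le (lintegral_congr fun x => ?_) h
  rw [enorm_tilt_sq, enorm_tilt_sq, ENNReal.mul_rpow_of_nonneg _ _ h0.le, mul_assoc,
    ← ENNReal.rpow_add_of_nonneg _ _ h0.le (sub_pos.2 h1).le, add_sub_cancel, ENNReal.rpow_one,
    ENNReal.ofReal_rpow_of_nonneg (Real.exp_nonneg _) h0.le, ← Real.exp_mul,
    real_inner_smul_left]
  congr 3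
  ring

theorem lintegral_tilt_ftFun_chirp_le_of_pos {A : ℝ} (hA : 0 < A) {g : Rn n → ℂ}
    (hg : MemLp (fun x => (Real.exp (A * ‖x‖ ^ 2) : ℂ) * g x) 2) (τ : ℝ)
    {θ : ℝ} (h0 : 0 < θ) (h1 : θ < 1) {ε : ℝ} (hε : 0 < ε) (ν : Rn n) :
    ∫⁻ ξ, ‖tilt (-(θ • ν)) (ftFun fun x =>
        Complex.exp (shiftExp (ε + Complex.I * τ) 0 0 x) * ftInvFun g x) ξ‖ₑ ^ 2 ≤
      (ENNReal.ofReal (Real.exp (2 * ε * ‖ν‖ ^ 2)) * ∫⁻ x, ‖tilt (-ν) g x‖ₑ ^ 2) ^ θ *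
        (∫⁻ x, ‖tilt ((2 * τ * θ / (1 - θ)) • ν) (ftInvFun g) x‖ₑ ^ 2) ^ (1 - θ) := by
  have hgi := integrable_of_memLp_weight one_le_two hA hg
  have hgt : ∀ ν, Integrable (tilt ν g) := fun ν => integrable_tilt hA ν hg
  have h1' : 1 - θ ≠ 0 := (sub_pos.2 h1).ne'
  -- At height `θν` the auxiliary factor has linear exponent `2T(1-θ) x·ν`, which must equal `2τθ
  -- x·ν`. With `μ = 2Tν` the linear exponent vanishes at height `ν`.
  set T : ℝ := τ * θ / (1 - θ) with hT
  set μ : Rn n := (2 * T) • ν with hμ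
  have hb : 0 < ((ε : ℂ) + Complex.I * τ).re := by simpa using hε
  have hb' : 0 < ((ε : ℂ) - Complex.I * T).re := by simpa using hε
  have hb're : ((ε : ℂ) - Complex.I * T).re = ε := by simp
  have hb'im : ((ε : ℂ) - Complex.I * T).im = -T := by simp
  have hbre : ((ε : ℂ) + Complex.I * τ).re = ε := by simp
  have hbim : ((ε : ℂ) + Complex.I * τ).im = τ := by simp
  set K := ftFun fun x => Complex.exp (shiftExp (ε - Complex.I * T) μ 0 x) * ftInvFun g x with hK
  have hKc : Continuous K := continuous_ftFun (integrable_cexp_shiftExp_mul hgi hb' μ 0)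
  have step : ∫⁻ ξ, ‖tilt (-(θ • ν)) (ftFun fun x =>
      Complex.exp (shiftExp (ε + Complex.I * τ) 0 0 x) * ftInvFun g x) ξ‖ₑ ^ 2 =
      ∫⁻ ξ, ‖tilt (θ • (-ν)) K ξ‖ₑ ^ 2 := by
    rw [smul_neg, lintegral_tilt_ftFun_sq hgi (hgt _) hb, hK,
      lintegral_tilt_ftFun_sq hgi (hgt _) hb']
    refine lintegral_congr fun x => ?_
    congr 4
    rw [re_shiftExp, re_shiftExp, hbre, hbim, hb're, hb'im, hμ, inner_zero_left,
      real_inner_smul_left, real_inner_smul_right, real_inner_comm ν x, hT]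
    field_simp
    ring
  rw [step]
  refine (lintegral_tilt_sq_le_interpolate hKc.aestronglyMeasurable h0 h1 (-ν)).trans ?_
  refine mul_le_mul' (ENNReal.rpow_le_rpow ?_ h0.le) (ENNReal.rpow_le_rpow ?_ (sub_pos.2 h1).le)
  · rw [hK, lintegral_tilt_ftFun_sq hgi (hgt _) hb',
      ← lintegral_ftInvFun_sq (hgt (-ν)) (memLp_two_tilt hA (-ν) hg),
      ← lintegral_const_mul' _ _ ENNReal.ofReal_ne_top]
    refine lintegral_mono fun x => mul_le_mul_left ?_ _
    refine ENNReal.ofReal_le_ofReal (Real.exp_le_exp.2 ?_)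
    rw [re_shiftExp, hb're, hb'im, hμ, real_inner_smul_left, real_inner_comm ν x]
    nlinarith [mul_nonneg hε.le (sq_nonneg ‖x‖)]
  · have h := lintegral_tilt_ftFun_sq hgi (ν := 0) (hgt _) hb' μ
    rw [neg_zero, tilt_zero, tilt_zero] at h
    rw [hK, h]
    refine lintegral_mono fun x => ?_
    rw [enorm_tilt_sq]
    refine mul_le_mul_left (ENNReal.ofReal_le_ofReal (Real.exp_le_exp.2 ?_)) _
    rw [re_shiftExp, hb're, hμ, hT, inner_zero_right, norm_zero]
    have e : 2 * (τ * θ / (1 - θ)) = 2 * τ * θ / (1 - θ) := by ring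
    rw [e]
    nlinarith [mul_nonneg hε.le (sq_nonneg ‖x‖)]

theorem tendsto_ftFun_regularized {h : Rn n → ℂ} (hh : Integrable h) (τ : ℝ) (ξ : Rn n) :
    Filter.Tendsto (fun j : ℕ => ftFun (fun x =>
      Complex.exp (shiftExp (((1 / ((j : ℝ) + 1) : ℝ) : ℂ) + Complex.I * τ) 0 0 x) * h x) ξ)
      Filter.atTop (nhds (ftFun (fun x => chirp n τ x * h x) ξ)) := by
  refine Filter.Tendsto.const_mul _ ?_
  refine tendsto_integral_of_dominated_convergence (fun x => ‖h x‖) (fun j => ?_) hh.norm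
    (fun j => Filter.Eventually.of_forall fun x => ?_) (Filter.Eventually.of_forall fun x => ?_)
  · have hc := continuous_shiftExp (n := n)
      (((1 / ((j : ℝ) + 1) : ℝ) : ℂ) + Complex.I * τ) 0 0
    exact AEStronglyMeasurable.mul (by fun_prop)
      (hc.cexp.aestronglyMeasurable.mul hh.aestronglyMeasurable)
  · rw [norm_mul, norm_mul, Complex.norm_exp, Complex.norm_exp, re_shiftExp]
    have e1 : (-(Complex.I * ((inner ℝ x ξ : ℝ) : ℂ))).re = 0 := by simp
    have e2 : (((1 / ((j : ℝ) + 1) : ℝ) : ℂ) + Complex.I * τ).re = 1 / ((j : ℝ) + 1) := by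
      rw [Complex.add_re, Complex.ofReal_re]
      simp
    rw [e1, e2, Real.exp_zero, one_mul]
    refine mul_le_of_le_one_left (norm_nonneg _) (Real.exp_le_one_iff.2 ?_)
    simp only [norm_zero, inner_zero_left, inner_zero_right]
    have : 0 ≤ 1 / ((j : ℝ) + 1) * ‖x‖ ^ 2 := by positivity
    nlinarith
  · refine Filter.Tendsto.const_mul _ (Filter.Tendsto.mul_const _ ?_)
    have ht : Filter.Tendsto (fun j : ℕ => ((1 / ((j : ℝ) + 1) : ℝ) : ℂ)) Filter.atTop
        (nhds 0) := by
      have := (Complex.continuous_ofReal.tendsto 0).comp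
        (tendsto_one_div_add_atTop_nhds_zero_nat (𝕜 := ℝ))
      rwa [Complex.ofReal_zero] at this
    have hc : Continuous fun z : ℂ => Complex.exp (shiftExp (n := n) (z + Complex.I * τ) 0 0 x) := by
      unfold shiftExp
      fun_prop
    have h2 := (hc.tendsto 0).comp ht
    have e : Complex.exp (shiftExp (n := n) (0 + Complex.I * τ) 0 0 x) = chirp n τ x := by
      rw [chirp, shiftExp]
      congr 1
      simp
    rw [e] at h2
    exact h2

/-- Limit `ε = 1/(j+1) → 0`: the regularized transforms converge pointwise, Fatou controls the left
side, and the loss `e^{2ε|ν|²θ}` tends to one. -/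
theorem lintegral_tilt_ftFun_chirp_le {A : ℝ} (hA : 0 < A) {g : Rn n → ℂ}
    (hg : MemLp (fun x => (Real.exp (A * ‖x‖ ^ 2) : ℂ) * g x) 2)
    (hh : Integrable (ftInvFun g)) (τ : ℝ) {θ : ℝ} (h0 : 0 < θ) (h1 : θ < 1) (ν : Rn n) :
    ∫⁻ ξ, ‖tilt (-(θ • ν)) (ftFun fun x => chirp n τ x * ftInvFun g x) ξ‖ₑ ^ 2 ≤
      (∫⁻ x, ‖tilt (-ν) g x‖ₑ ^ 2) ^ θ *
        (∫⁻ x, ‖tilt ((2 * τ * θ / (1 - θ)) • ν) (ftInvFun g) x‖ₑ ^ 2) ^ (1 - θ) := by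
  have hgi := integrable_of_memLp_weight one_le_two hA hg
  have hpos : ∀ j : ℕ, 0 < 1 / ((j : ℝ) + 1) := fun j => by positivity
  set X := ∫⁻ x, ‖tilt (-ν) g x‖ₑ ^ 2
  set Y := (∫⁻ x, ‖tilt ((2 * τ * θ / (1 - θ)) • ν) (ftInvFun g) x‖ₑ ^ 2) ^ (1 - θ)
  let G : ℕ → Rn n → ℂ := fun j => ftFun fun x =>
    Complex.exp (shiftExp (((1 / ((j : ℝ) + 1) : ℝ) : ℂ) + Complex.I * τ) 0 0 x) * ftInvFun g x
  have hle : ∀ j, ∫⁻ ξ, ‖tilt (-(θ • ν)) (G j) ξ‖ₑ ^ 2 ≤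
      ENNReal.ofReal (Real.exp (2 * (1 / ((j : ℝ) + 1)) * ‖ν‖ ^ 2 * θ)) * (X ^ θ * Y) := by
    intro j
    refine (lintegral_tilt_ftFun_chirp_le_of_pos hA hg τ h0 h1 (hpos j) ν).trans_eq ?_
    rw [ENNReal.mul_rpow_of_nonneg _ _ h0.le,
      ENNReal.ofReal_rpow_of_nonneg (Real.exp_nonneg _) h0.le, ← Real.exp_mul, mul_assoc]
  have hlim : Filter.Tendsto (fun j : ℕ => ENNReal.ofReal
      (Real.exp (2 * (1 / ((j : ℝ) + 1)) * ‖ν‖ ^ 2 * θ)) * (X ^ θ * Y)) Filter.atTop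
      (nhds (X ^ θ * Y)) := by
    have hc : Continuous fun s : ℝ => ENNReal.ofReal (Real.exp (2 * s * ‖ν‖ ^ 2 * θ)) :=
      ENNReal.continuous_ofReal.comp (by fun_prop)
    have h2 := (hc.tendsto 0).comp (tendsto_one_div_add_atTop_nhds_zero_nat (𝕜 := ℝ))
    simp only [mul_zero, zero_mul, Real.exp_zero, ENNReal.ofReal_one] at h2
    have h3 := ENNReal.Tendsto.mul_const (b := X ^ θ * Y) h2 (Or.inl one_ne_zero)
    rwa [one_mul] at h3
  calc ∫⁻ ξ, ‖tilt (-(θ • ν)) (ftFun fun x => chirp n τ x * ftInvFun g x) ξ‖ₑ ^ 2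
      = ∫⁻ ξ, Filter.liminf (fun j => ‖tilt (-(θ • ν)) (G j) ξ‖ₑ ^ 2) Filter.atTop := by
        refine lintegral_congr fun ξ => (Filter.Tendsto.liminf_eq ?_).symm
        have h2 := (tendsto_ftFun_regularized hh τ ξ).const_mul
          (Real.exp (inner ℝ (-(θ • ν)) ξ) : ℂ)
        exact ((ENNReal.continuous_pow 2).tendsto _).comp ((continuous_enorm.tendsto _).comp h2)
    _ ≤ Filter.liminf (fun j => ∫⁻ ξ, ‖tilt (-(θ • ν)) (G j) ξ‖ₑ ^ 2) Filter.atTop := by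
        refine lintegral_liminf_le fun j => measurable_tilt_ftFun _
          (integrable_cexp_shiftExp_mul hgi ?_ 0 0)
        rw [Complex.add_re, Complex.ofReal_re]
        simpa using hpos j
    _ ≤ Filter.liminf (fun j : ℕ => ENNReal.ofReal
          (Real.exp (2 * (1 / ((j : ℝ) + 1)) * ‖ν‖ ^ 2 * θ)) * (X ^ θ * Y)) Filter.atTop :=
        Filter.liminf_le_liminf (Filter.Eventually.of_forall hle)
    _ = X ^ θ * Y := hlim.liminf_eq

/-! ### From linear to Gaussian weights -/

theorem norm_chirp (s : ℝ) (x : Rn n) : ‖chirp n s x‖ = 1 := by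
  simp [chirp, Complex.norm_exp, -Complex.ofReal_pow]

theorem continuous_chirp (s : ℝ) : Continuous (chirp n s) := by
  unfold chirp
  fun_prop

theorem integrable_chirp_mul (s : ℝ) {F : Rn n → ℂ} (hF : Integrable F) :
    Integrable fun x => chirp n s x * F x :=
  hF.bdd_mul (continuous_chirp s).aestronglyMeasurable
    (Filter.Eventually.of_forall fun x => (norm_chirp s x).le)

theorem aemeasurable_tilt_sq_uncurry (s : ℝ) {F : Rn n → ℂ}
    (hF : AEStronglyMeasurable F volume) :
    AEMeasurable (Function.uncurry fun ν x : Rn n => ‖tilt (s • ν) F x‖ₑ ^ 2)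
      (volume.prod volume) := by
  have h1 : Continuous fun z : Rn n × Rn n => (Real.exp (inner ℝ (s • z.1) z.2) : ℂ) := by fun_prop
  have h2 : AEStronglyMeasurable (fun z : Rn n × Rn n => F z.2) (volume.prod volume) := hF.comp_snd
  exact (h1.aestronglyMeasurable.mul h2).enorm.pow_const 2

/-- Averaging the linear weights `e^{2 s ν·x}` over a Gaussian in `ν` gives a Gaussian weight. -/
theorem lintegral_gaussian_mul_tilt_sq {κ : ℝ} (hκ : 0 < κ) (s : ℝ) {F : Rn n → ℂ}
    (hF : AEStronglyMeasurable F volume) :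
    ∫⁻ ν : Rn n, ENNReal.ofReal (Real.exp (-(κ * ‖ν‖ ^ 2))) * ∫⁻ x, ‖tilt (s • ν) F x‖ₑ ^ 2 =
      (∫⁻ ν : Rn n, ENNReal.ofReal (Real.exp (-(κ * ‖ν‖ ^ 2)))) *
        ∫⁻ x, ENNReal.ofReal (Real.exp (s ^ 2 / κ * ‖x‖ ^ 2)) * ‖F x‖ₑ ^ 2 := by
  simp only [← lintegral_const_mul' _ _ ENNReal.ofReal_ne_top]
  rw [lintegral_lintegral_swap]
  · have hx : ∀ x, ∫⁻ ν : Rn n, ENNReal.ofReal (Real.exp (-(κ * ‖ν‖ ^ 2))) *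
        ‖tilt (s • ν) F x‖ₑ ^ 2 =
        (∫⁻ ν : Rn n, ENNReal.ofReal (Real.exp (-(κ * ‖ν‖ ^ 2)))) *
          (ENNReal.ofReal (Real.exp (s ^ 2 / κ * ‖x‖ ^ 2)) * ‖F x‖ₑ ^ 2) := by
      intro x
      -- Translating the Gaussian by `(s/κ)x` completes the square in `-κ|ν|² + 2sν·x`.
      rw [← lintegral_sub_right_eq_self
        (fun ν : Rn n => ENNReal.ofReal (Real.exp (-(κ * ‖ν‖ ^ 2)))) ((s / κ) • x),
        ← lintegral_mul_const' _ _ (by finiteness)]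
      refine lintegral_congr fun ν => ?_
      rw [enorm_tilt_sq, ← mul_assoc, ← mul_assoc, ← ENNReal.ofReal_mul (Real.exp_nonneg _),
        ← ENNReal.ofReal_mul (Real.exp_nonneg _), ← Real.exp_add, ← Real.exp_add]
      congr 3
      rw [norm_sub_sq_real, real_inner_smul_left, real_inner_smul_right, norm_smul, mul_pow,
        Real.norm_eq_abs, sq_abs]
      field_simp
      ring
    simp only [hx]
    rw [lintegral_const_mul' _ _ (lintegral_gaussian_ne_top hκ)]
  · have h1 : AEMeasurable (fun z : Rn n × Rn n => ENNReal.ofReal (Real.exp (-(κ * ‖z.1‖ ^ 2))))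
        (volume.prod volume) := by fun_prop
    exact h1.mul (aemeasurable_tilt_sq_uncurry s hF)

theorem enorm_weight_sq (A : ℝ) (F : Rn n → ℂ) (x : Rn n) :
    ‖(Real.exp (A * ‖x‖ ^ 2) : ℂ) * F x‖ₑ ^ 2 =
      ENNReal.ofReal (Real.exp (2 * A * ‖x‖ ^ 2)) * ‖F x‖ₑ ^ 2 := by
  rw [enorm_mul, mul_pow, ← ofReal_norm (Real.exp _ : ℂ), Complex.norm_real,
    Real.norm_of_nonneg (Real.exp_nonneg _), ← ENNReal.ofReal_pow (Real.exp_nonneg _),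
    ← Real.exp_nat_mul]
  congr 3
  push_cast
  ring

theorem memLp_two_iff_lintegral_sq_ne_top {F : Rn n → ℂ} (hF : AEStronglyMeasurable F volume) :
    MemLp F 2 ↔ ∫⁻ x, ‖F x‖ₑ ^ 2 ≠ ⊤ := by
  rw [← eLpNorm_two_sq, ENNReal.pow_ne_top_iff]
  constructor
  · exact fun h => Or.inl h.eLpNorm_ne_top
  · rintro (h | h)
    · exact ⟨hF, h.lt_top⟩
    · exact absurd h two_ne_zero

/-- The tilt inequality is integrated over `ν` against a Gaussian, with Hölder in `ν` on the right.
The condition `hθ` makes the averaged weight on `ftInvFun g` exactly the one available. -/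
theorem memLp_weight_ftFun_chirp_of_interpolation {C₁ C₂ : ℝ} (hC₁ : 0 < C₁) (hC₂ : 0 < C₂)
    {g : Rn n → ℂ} (hg : MemLp (fun x => (Real.exp (C₂ * ‖x‖ ^ 2) : ℂ) * g x) 2)
    (hh : MemLp (fun x => (Real.exp (C₁ * ‖x‖ ^ 2) : ℂ) * ftInvFun g x) 2) {τ θ : ℝ}
    (h0 : 0 < θ) (h1 : θ < 1) (hθ : (2 * τ * θ / (1 - θ)) ^ 2 * C₂ = C₁) :
    MemLp (fun ξ => (Real.exp (θ ^ 2 * C₂ * ‖ξ‖ ^ 2) : ℂ) *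
      ftFun (fun x => chirp n τ x * ftInvFun g x) ξ) 2 := by
  have hgi := integrable_of_memLp_weight one_le_two hC₂ hg
  have hhi := integrable_of_memLp_weight one_le_two hC₁ hh
  have hci := integrable_chirp_mul τ hhi
  set G := ftFun fun x => chirp n τ x * ftInvFun g x with hG
  have hGc : Continuous G := continuous_ftFun hci
  set m := 2 * τ * θ / (1 - θ) with hm
  -- Averaging the tilt by `sν` gives the exponent `s²/κ = 2C₂s²`; thus `s = -1` yields the squared
  -- weight of `g`.
  set κ := 1 / (2 * C₂) with hκd
  have hκ : 0 < κ := by positivity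
  set W := ∫⁻ ν : Rn n, ENNReal.ofReal (Real.exp (-(κ * ‖ν‖ ^ 2))) with hW
  have hWt : W ≠ ⊤ := lintegral_gaussian_ne_top hκ
  have hW0 : W ≠ 0 := by
    refine ((lintegral_pos_iff_support (by fun_prop)).2 ?_).ne'
    have hsupp : (Function.support fun ν : Rn n =>
        ENNReal.ofReal (Real.exp (-(κ * ‖ν‖ ^ 2)))) = Set.univ :=
      Set.eq_univ_of_forall fun ν => by simp [Real.exp_pos]
    rw [hsupp]
    exact isOpen_univ.measure_pos volume Set.univ_nonempty
  have hwm : AEMeasurable (fun ν : Rn n => ENNReal.ofReal (Real.exp (-(κ * ‖ν‖ ^ 2)))) volume := by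
    fun_prop
  have e1 : ((-θ) ^ 2 / κ) = 2 * (θ ^ 2 * C₂) := by rw [hκd]; field_simp
  have e2 : ((-1 : ℝ) ^ 2 / κ) = 2 * C₂ := by rw [hκd]; field_simp
  have e3 : m ^ 2 / κ = 2 * C₁ := by rw [← hθ, hκd]; field_simp
  have aG := lintegral_gaussian_mul_tilt_sq hκ (-θ) hGc.aestronglyMeasurable
  have ag := lintegral_gaussian_mul_tilt_sq hκ (-1) hgi.aestronglyMeasurable
  have ah := lintegral_gaussian_mul_tilt_sq hκ m hhi.aestronglyMeasurable
  rw [e1] at aG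
  rw [e2] at ag
  rw [e3] at ah
  simp only [← enorm_weight_sq] at aG ag ah
  have hmain : W * ∫⁻ ξ, ‖(Real.exp (θ ^ 2 * C₂ * ‖ξ‖ ^ 2) : ℂ) * G ξ‖ₑ ^ 2 ≤
      (W * ∫⁻ x, ‖(Real.exp (C₂ * ‖x‖ ^ 2) : ℂ) * g x‖ₑ ^ 2) ^ θ *
      (W * ∫⁻ x, ‖(Real.exp (C₁ * ‖x‖ ^ 2) : ℂ) * ftInvFun g x‖ₑ ^ 2) ^ (1 - θ) := by
    rw [← aG, ← ag, ← ah]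
    refine le_trans (lintegral_mono fun ν => ?_) (ENNReal.lintegral_mul_norm_pow_le
      (hwm.mul (aemeasurable_tilt_sq_uncurry (-1) hgi.aestronglyMeasurable).lintegral_prod_right')
      (hwm.mul (aemeasurable_tilt_sq_uncurry m hhi.aestronglyMeasurable).lintegral_prod_right')
      h0.le (sub_pos.2 h1).le (add_sub_cancel θ 1))
    have h := lintegral_tilt_ftFun_chirp_le hC₂ hg hhi τ h0 h1 ν
    simp only [Function.uncurry, Pi.mul_apply]
    rw [ENNReal.mul_rpow_of_nonneg _ _ h0.le, ENNReal.mul_rpow_of_nonneg _ _ (sub_pos.2 h1).le,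
      mul_mul_mul_comm, ← ENNReal.rpow_add_of_nonneg _ _ h0.le (sub_pos.2 h1).le, add_sub_cancel,
      ENNReal.rpow_one, neg_smul, neg_smul, one_smul]
    exact mul_le_mul_right h _
  rw [memLp_two_iff_lintegral_sq_ne_top hg.1] at hg
  rw [memLp_two_iff_lintegral_sq_ne_top hh.1] at hh
  refine (memLp_two_iff_lintegral_sq_ne_top
    (AEStronglyMeasurable.mul (by fun_prop) hGc.aestronglyMeasurable)).2 fun htop => ?_
  simp only [Pi.mul_apply] at htop
  rw [htop, ENNReal.mul_top hW0, top_le_iff] at hmain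
  exact ENNReal.mul_ne_top
    (ENNReal.rpow_ne_top_of_nonneg h0.le (ENNReal.mul_ne_top hWt hg))
    (ENNReal.rpow_ne_top_of_nonneg (sub_pos.2 h1).le (ENNReal.mul_ne_top hWt hh)) hmain

/-- With `C₁ = a²` and `C₂ = b²`, the interpolation condition is solved by `θ = a/(a + 2τb)`, and
the denominator in the claim is the square `(a + 2τb)²`. -/
theorem memLp_weight_ftFun_chirp {C₁ C₂ τ : ℝ} (hC₁ : 0 < C₁) (hC₂ : 0 < C₂) (hτ : 0 < τ)
    {g : Rn n → ℂ} (hg : MemLp (fun x => (Real.exp (C₂ * ‖x‖ ^ 2) : ℂ) * g x) 2)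
    (hh : MemLp (fun x => (Real.exp (C₁ * ‖x‖ ^ 2) : ℂ) * ftInvFun g x) 2) :
    MemLp (fun ξ => (Real.exp (C₁ * C₂ / (C₁ + 4 * τ * √(C₁ * C₂) + 4 * τ ^ 2 * C₂) *
      ‖ξ‖ ^ 2) : ℂ) * ftFun (fun x => chirp n τ x * ftInvFun g x) ξ) 2 := by
  obtain ⟨a, ha, rfl⟩ : ∃ a, 0 < a ∧ a ^ 2 = C₁ := ⟨√C₁, Real.sqrt_pos.2 hC₁, Real.sq_sqrt hC₁.le⟩
  obtain ⟨b, hb, rfl⟩ : ∃ b, 0 < b ∧ b ^ 2 = C₂ := ⟨√C₂, Real.sqrt_pos.2 hC₂, Real.sq_sqrt hC₂.le⟩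
  have hs : √(a ^ 2 * b ^ 2) = a * b := by
    rw [← mul_pow]
    exact Real.sqrt_sq (by positivity)
  have hpos : 0 < a + 2 * τ * b := by positivity
  have h1θ : 1 - a / (a + 2 * τ * b) = 2 * τ * b / (a + 2 * τ * b) := by
    field_simp
    ring
  have h := memLp_weight_ftFun_chirp_of_interpolation hC₁ hC₂ hg hh (τ := τ)
    (θ := a / (a + 2 * τ * b)) (by positivity)
    (by rw [div_lt_one hpos]; nlinarith [mul_pos hτ hb])
    (by rw [h1θ]; field_simp)
  have e : a ^ 2 * b ^ 2 / (a ^ 2 + 4 * τ * √(a ^ 2 * b ^ 2) + 4 * τ ^ 2 * b ^ 2) =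
      (a / (a + 2 * τ * b)) ^ 2 * b ^ 2 := by
    rw [hs, show a ^ 2 + 4 * τ * (a * b) + 4 * τ ^ 2 * b ^ 2 = (a + 2 * τ * b) ^ 2 by ring]
    field_simp
  rw [e]
  exact h

/-! ### The chirp and the Schrödinger group on distributions -/

theorem memLp_weight_chirp_mul {p : ℝ≥0∞} {A : ℝ} (s : ℝ) {F : Rn n → ℂ} (hF : Integrable F)
    (hw : MemLp (fun x => (Real.exp (A * ‖x‖ ^ 2) : ℂ) * F x) p) :
    MemLp (fun x => (Real.exp (A * ‖x‖ ^ 2) : ℂ) * (chirp n s x * F x)) p := by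
  refine hw.of_le (AEStronglyMeasurable.mul (by fun_prop)
    (integrable_chirp_mul s hF).aestronglyMeasurable) (Filter.Eventually.of_forall fun x => ?_)
  simp only [norm_mul, norm_chirp, one_mul, le_refl]

theorem IsGivenBy.chirpMul {f : 𝓢'(Rn n, ℂ)} {F : Rn n → ℂ} (hf : IsGivenBy f F)
    (hF : Integrable F) (s : ℝ) : IsGivenBy (chirpMul s f) fun x => chirp n s x * F x := by
  have hi := integrable_chirp_mul s hF
  refine ⟨hi.locallyIntegrable, fun φ => ⟨integrable_schwartz_mul φ hi, ?_⟩⟩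
  rw [GaussianDecay.chirpMul, TemperedDistribution.smulLeftCLM_apply_apply, (hf.2 _).2]
  refine integral_congr_ae (Filter.Eventually.of_forall fun x => ?_)
  simp only [SchwartzMap.smulLeftCLM_apply_apply (chirp_hasTemperateGrowth n s), smul_eq_mul]
  ring

theorem IsO.ftInv {p q : ℝ≥0∞} (hp : 1 ≤ p) {A₁ A₂ : ℝ} (hA₁ : 0 < A₁) {f : 𝓢'(Rn n, ℂ)}
    (hf : IsO p q A₁ A₂ f) : IsO q p A₂ A₁ (ftInv f) := by
  obtain ⟨⟨F, hF, hFw⟩, ⟨U, hU, hUw⟩⟩ := hf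
  have hFi := integrable_of_memLp_weight hp hA₁ hFw
  refine ⟨⟨fun x => U (-x), ?_, memLp_weight_comp_neg hUw⟩, ?_⟩
  · refine (hF.ftInv hFi).congr ?_
    have h := ae_eq_comp_neg ((hF.ft hFi).ae_eq hU)
    simp only [← ftInvFun_eq_ftFun_neg] at h
    exact h
  · rw [ft_ftInv]
    exact ⟨F, hF, hFw⟩

theorem IsO.chirpMul {C₁ C₂ : ℝ} (hC₁ : 0 < C₁) (hC₂ : 0 < C₂) {h : 𝓢'(Rn n, ℂ)}
    (hh : IsO 2 2 C₁ C₂ h) {τ : ℝ} (hτ : 0 < τ) :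
    IsO 2 2 C₁ (C₁ * C₂ / (C₁ + 4 * τ * √(C₁ * C₂) + 4 * τ ^ 2 * C₂)) (chirpMul τ h) := by
  obtain ⟨⟨H, hH, hHw⟩, ⟨g, hg, hgw⟩⟩ := hh
  have hgi := integrable_of_memLp_weight one_le_two hC₂ hgw
  have hae := hH.ae_eq_ftInvFun hg hgi
  replace hH := hH.congr hae
  replace hHw := memLp_weight_congr hae hHw
  have hHi := integrable_of_memLp_weight one_le_two hC₁ hHw
  have hk := hH.chirpMul hHi τ
  exact ⟨⟨_, hk, memLp_weight_chirp_mul τ hHi hHw⟩,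
    ⟨_, hk.ft (integrable_chirp_mul τ hHi), memLp_weight_ftFun_chirp hC₁ hC₂ hτ hgw hHw⟩⟩

/-- On the Fourier side the group is the chirp, so the roles of `C₁` and `C₂` are exchanged. -/
theorem IsO.schrodinger {C₁ C₂ : ℝ} (hC₁ : 0 < C₁) (hC₂ : 0 < C₂) {h : 𝓢'(Rn n, ℂ)}
    (hh : IsO 2 2 C₁ C₂ h) {t : ℝ} (ht : 0 < t) :
    IsO 2 2 (C₁ * C₂ / (C₂ + 4 * t * √(C₁ * C₂) + 4 * t ^ 2 * C₁)) C₂ (schrodinger t h) := by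
  have h1 := (((hh.ft one_le_two hC₁).chirpMul hC₂ hC₁ ht).ftInv one_le_two hC₂)
  rw [mul_comm C₂ C₁] at h1
  exact h1

end GaussianDecay

end

open GaussianDecay in
theorem lemma2p3 (n : ℕ) (p q r l : ℝ≥0∞) (hp : 1 ≤ p) (hq : 1 ≤ q) (hr : 1 ≤ r)
    (hl : 1 / p + 1 / r = 1 / l)
    (A₁ A₂ B₁ B₂ C₁ C₂ : ℝ) (hA₁ : 0 < A₁) (hA₂ : 0 < A₂) (hB₁ : 0 < B₁) (hB₂ : 0 < B₂)
    (hC₁ : 0 < C₁) (hC₂ : 0 < C₂) :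
    -- (a)
    (∀ f : 𝓢'(Rn n, ℂ), IsO p q A₁ A₂ f → IsO q p A₂ A₁ (ft f)) ∧
    -- (b)
    (∀ f g : 𝓢'(Rn n, ℂ), IsO p q A₁ A₂ f → IsO r q B₁ B₂ g →
      (∃ k, IsProduct f g k) ∧
      (∀ k, IsProduct f g k → IsO l q (A₁ + B₁) (A₂ * B₂ / (A₂ + B₂)) k) ∧
      M (A₁ + B₁) (A₂ * B₂ / (A₂ + B₂)) ≤
        B₂ / (A₂ + B₂) * M A₁ A₂ + A₂ / (A₂ + B₂) * M B₁ B₂) ∧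
    -- (c)
    (∀ f g : 𝓢'(Rn n, ℂ), IsO q p A₁ A₂ f → IsO q r B₁ B₂ g →
      (∃ k, IsConvolution g f k) ∧
      ∀ k, IsConvolution g f k → IsO q l (A₁ * B₁ / (A₁ + B₁)) (A₂ + B₂) k) ∧
    -- (d)
    (∀ h : 𝓢'(Rn n, ℂ), IsO 2 2 C₁ C₂ h → ∀ t : ℝ, 0 < t →
      IsO 2 2 (C₁ * C₂ / (C₂ + 4 * t * √(C₁ * C₂) + 4 * t ^ 2 * C₁)) C₂ (schrodinger t h)) ∧
    -- (e)
    (∀ h : 𝓢'(Rn n, ℂ), IsO 2 2 C₁ C₂ h → ∀ τ : ℝ, 0 < τ →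
      IsO 2 2 C₁ (C₁ * C₂ / (C₁ + 4 * τ * √(C₁ * C₂) + 4 * τ ^ 2 * C₂)) (chirpMul τ h)) := by
  refine ⟨fun f hf => hf.ft hp hA₁, fun f g hf hg => ⟨exists_isProduct hp hq hA₁ hB₂ hf hg,
    fun k hk => hk.isO hq hl hA₂ hB₂ hf hg, le_of_eq ?_⟩,
    fun f g hf hg => ⟨exists_isConvolution hq hA₁ hB₁ hf hg,
      fun k hk => hk.isO hq hl hA₁ hB₁ hf hg⟩,
    fun h hh t ht => hh.schrodinger hC₁ hC₂ ht, fun h hh τ hτ => hh.chirpMul hC₁ hC₂ hτ⟩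
  -- The bound on the attached number is in fact an equality.
  simp only [M]
  field_simp
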